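/- Let $n,p,M$ be integers and let $\mathcal S\sqcup\mathcal T=[p]$ be a partition with $s=|\mathcal S|$, $t=|\mathcal T|$, $n>s$. Let $\mathbf X\in\mathbb R^{n\times p}$ be a random matrix whose rows are i.i.d. $N_p(0,\Sigma)$, where $\Sigma$ is positive semidefinite and $\Sigma_{\mathcal S\mathcal S}$ is positive definite, and let $\mathbf X_{\mathcal S},\mathbf X_{\mathcal T}$ be the submatrices of the corresponding columns. Let $\mathbf Y$ be a random vector in $\mathbb R^n$. Let $\mathbf P\in\mathbb R^{(n-s)\times n}$ be a (possibly data-dependent) random matrix that, whenever $\mathbf X_{\mathcal S}^\top\mathbf X_{\mathcal S}$ is invertible, satisfies almost surely $$\mathbf P\mathbf P^\top=\mathbf I_{n-s},\qquad \mathbf P^\top\mathbf P=\mathbf I_n-\mathbf X_{\mathcal S}(\mathbf X_{\mathcal S}^\top\mathbf X_{\mathcal S})^{-1}\mathbf X_{\mathcal S}^\top .$$ Put $r=\min\{n-s,t\}$ and $$\mathbf Q=\begin{cases}(\mathbf X_{\mathcal T}^\top\mathbf P^\top\mathbf P\mathbf X_{\mathcal T})^{1/2}, & n-s>t,\\ \mathbf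 P\mathbf X_{\mathcal T}, & n-s\le t,\end{cases}\qquad \mathbf Q\in\mathbb R^{r\times t}.$$ For $j=1,\dots,M$ draw standard normal vectors $v^{j}_1,\dots,v^{j}_r$ in $\mathbb R^{n-s}$, all independent of each other and jointly independent of $(\mathbf Y,\mathbf X,\mathbf P)$, let $U^{(j)}\in\mathbb R^{(n-s)\times r}$ have as columns the Gram--Schmidt orthonormalization of $v^{j}_1,\dots,v^{j}_r$, and define the copies $$\widetilde{\mathbf X}_{\mathcal T}^{(j)}=\mathbf X_{\mathcal S}(\mathbf X_{\mathcal S}^\top\mathbf X_{\mathcal S})^{-1}\mathbf X_{\mathcal S}^\top\mathbf X_{\mathcal T}+\mathbf P^\top U^{(j)}\mathbf Q .$$ Then: 1. Almost surely, for all $j=1,\dots,M$, $$\mathbf X_{\mathcal T}^\top\mathbf X_{\mathcal S}=(\widetilde{\mathbf X}_{\mathcal T}^{(j)})^\top\mathbf X_{\mathcal S},\qquad \mathbf X_{\mathcal T}^\top\mathbf X_{\mathcal T}=(\widetilde{\mathbf X}_{\mathcal T}^{(j)})^\top\widetilde{\mathbf X}_{\mathcal T}^{(j)} .$$ 2. If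 $\mathbf Y$ and $\mathbf X_{\mathcal T}$ are conditionally independent given $\mathbf X_{\mathcal S}$, then for every measurable real-valued statistic $T$, with $T_0=T(\mathbf Y,\mathbf X_{\mathcal T},\mathbf X_{\mathcal S})$, $T_m=T(\mathbf Y,\widetilde{\mathbf X}_{\mathcal T}^{(m)},\mathbf X_{\mathcal S})$ and $$\mathrm{pVal}_T=\frac1{M+1}\Bigl(1+\sum_{m=1}^M\mathbf 1\{T_m\ge T_0\}\Bigr),$$ one has $\mathbb P(\mathrm{pVal}_T\le\alpha)\le\alpha$ for all $\alpha\in(0,1)$. -/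

import Mathlib

open MeasureTheory ProbabilityTheory
open scoped Matrix MatrixOrder

noncomputable section

namespace MVNCRT

/-- Real matrices carry the product (equivalently, Borel) sigma-algebra of their entries. -/
instance instMeasurableSpaceMatrix {m k : Type*} : MeasurableSpace (Matrix m k ℝ) :=
  inferInstanceAs (MeasurableSpace (m → k → ℝ))

/-- The columns of `X` with index in `A`, in increasing order. -/
def cols {n p : ℕ} (X : Matrix (Fin n) (Fin p) ℝ) (A : Finset (Fin p)) :
    Matrix (Fin n) (Fin A.card) ℝ :=
  X.submatrix id (A.orderEmbOfFin rfl)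

/-- The principal submatrix of `C` with row and column indices in `A`, in increasing order. -/
def principal {p : ℕ} (C : Matrix (Fin p) (Fin p) ℝ) (A : Finset (Fin p)) :
    Matrix (Fin A.card) (Fin A.card) ℝ :=
  C.submatrix (A.orderEmbOfFin rfl) (A.orderEmbOfFin rfl)

/-- `f` and `g` are conditionally independent given `Z`:
`P(f ∈ A, g ∈ B | Z) = P(f ∈ A | Z) P(g ∈ B | Z)` a.s. for all measurable `A`, `B`.
Unlike Mathlib's `CondIndepFun`, this makes sense on every probability space. -/
def CondIndepGiven {Ω α β γ : Type*} [MeasurableSpace Ω] [MeasurableSpace α] [MeasurableSpace β]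
    [mγ : MeasurableSpace γ] (f : Ω → α) (g : Ω → β) (Z : Ω → γ) (μ : Measure Ω) : Prop :=
  ∀ (A : Set α) (B : Set β), MeasurableSet A → MeasurableSet B →
    μ⟦f ⁻¹' A ∩ g ⁻¹' B | mγ.comap Z⟧ =ᵐ[μ]
      μ⟦f ⁻¹' A | mγ.comap Z⟧ * μ⟦g ⁻¹' B | mγ.comap Z⟧

/-- On standard Borel spaces `CondIndepGiven` is Mathlib's conditional independence. -/
theorem condIndepGiven_iff {Ω α β γ : Type*} [MeasurableSpace Ω] [StandardBorelSpace Ω]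
    [MeasurableSpace α] [MeasurableSpace β] [mγ : MeasurableSpace γ] {f : Ω → α} {g : Ω → β}
    {Z : Ω → γ} (hf : Measurable f) (hg : Measurable g) (hZ : Measurable Z)
    (μ : Measure Ω) [IsFiniteMeasure μ] :
    CondIndepGiven f g Z μ ↔ CondIndepFun (mγ.comap Z) hZ.comap_le f g μ := by
  rw [condIndepFun_iff _ _ f g hf hg]
  constructor
  · rintro h _ _ ⟨A, hA, rfl⟩ ⟨B, hB, rfl⟩
    exact h A B hA hB
  · intro h A B hA hB
    exact h _ _ ⟨A, hA, rfl⟩ ⟨B, hB, rfl⟩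

variable {n s t : ℕ}

/-- `Z (Zᵀ Z)⁻¹ Zᵀ`, the orthogonal projection onto the column space of `Z`
(when `Zᵀ Z` is invertible). -/
def hat (Z : Matrix (Fin n) (Fin s) ℝ) : Matrix (Fin n) (Fin n) ℝ :=
  Z * (Zᵀ * Z)⁻¹ * Zᵀ

/-- `P` is an `(n - s) × n` matrix with `P Pᵀ = I` and `Pᵀ P = I - Z (Zᵀ Z)⁻¹ Zᵀ`. -/
def IsResidualFrame (Z : Matrix (Fin n) (Fin s) ℝ) (P : Matrix (Fin (n - s)) (Fin n) ℝ) : Prop :=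
  P * Pᵀ = 1 ∧ Pᵀ * P = 1 - hat Z

/-- The matrix `Q`, with `r = min (n - s) t` rows: the positive semidefinite square root of
`Wᵀ Pᵀ P W` if `n - s > t`, and `P W` if `n - s ≤ t` (`W` is the block of tested covariates). -/
def qMatrix (P : Matrix (Fin (n - s)) (Fin n) ℝ) (W : Matrix (Fin n) (Fin t) ℝ) :
    Matrix (Fin (min (n - s) t)) (Fin t) ℝ :=
  if h : t < n - s then
    (CFC.sqrt (Wᵀ * Pᵀ * P * W)).submatrix (Fin.cast (min_eq_right h.le)) id
  else
    (P * W).submatrix (Fin.cast (min_eq_left (not_lt.mp h))) id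

/-- The matrix whose columns are obtained from `v 0, v 1, …` by the Gram-Schmidt process. -/
def frame {d r : ℕ} (v : Fin r → EuclideanSpace ℝ (Fin d)) : Matrix (Fin d) (Fin r) ℝ :=
  Matrix.of fun i k => InnerProductSpace.gramSchmidtNormed ℝ v k i

/-- A copy of `W` generated from `Z`, `P` and the vectors `v`:
`Z (Zᵀ Z)⁻¹ Zᵀ W + Pᵀ U Q` where `U` is the Gram-Schmidt frame of `v`. -/
def copy (Z : Matrix (Fin n) (Fin s) ℝ) (W : Matrix (Fin n) (Fin t) ℝ)
    (P : Matrix (Fin (n - s)) (Fin n) ℝ)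
    (v : Fin (min (n - s) t) → EuclideanSpace ℝ (Fin (n - s))) : Matrix (Fin n) (Fin t) ℝ :=
  hat Z * W + Pᵀ * frame v * qMatrix P W

open Classical in
/-- The randomization p-value `(1 + #{m | T_m ≥ T_0}) / (M + 1)`. -/
def pVal {M : ℕ} (T0 : ℝ) (T : Fin M → ℝ) : ℝ :=
  (1 / ((M : ℝ) + 1)) * (1 + ∑ m, if T m ≥ T0 then (1 : ℝ) else 0)

end MVNCRT

end

open MeasureTheory ProbabilityTheory
open scoped Matrix MatrixOrder

noncomputable section

namespace MVNCRT

/-! Write `Z`, `W` for the blocks of columns in `S`, `T`. The first claim is algebra. Since `P Z =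
0`, `P Pᵀ = 1` and the frame `U` has orthonormal columns, the cross terms of the Gram matrix of a
copy vanish. What remains is `Wᵀ (hat Z) W + Qᵀ Q`, and `Qᵀ Q = Wᵀ Pᵀ P W` (`qMatrix_gram`)
completes it to `Wᵀ W`. This needs `Zᵀ Z` invertible and the Gaussian vectors linearly independent.
Both hold almost surely, because independent vectors that charge no hyperplane are almost surely
independent (`ae_linearIndependent_pi`).

For the second claim, regress: `W = Z B + E`, where the Gaussian residual `E` is independent of `Z`
and its law is invariant under left multiplication by orthogonal matrices
(`matrixGaussian_map_orthogonal`). Conditional independence makes `(Y, Z, W)` distributed as if `E`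
were independent of `(Y, Z)` (`CondIndepGiven.map_eq`). Fix `Y` and `Z`. For orthogonal `H`, the
matrix `hat Z + Pᵀ H P` is orthogonal and fixes `Z`, so applying it to `W` does not change the law
of `W`, and `H` may be randomized. Given `W`, the rotated block then has exactly the law of a copy
(`rotationLaw_map_residualRotation`), while the law of the copies is the same whether they are built
from `W` or from its rotation (`copyLaw_residualRotation`). Hence the rotated block and its copies
are i.i.d. given `W`, and a rank count bounds the p-value (`prod_pi_pVal_le`).

The identifications of laws rest on one principle: the law of `U q` depends only on `qᵀ q`
(`frameLaw_map_congr`). It follows from the invariance of Gaussian frames under rotations and from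
the fact that matrices with equal Gram matrices differ by an orthogonal factor. The same principle
shows that the law of the copies does not depend on which residual frame `P` is used
(`copyLaw_congr`), which disposes of the data dependence of `P`. -/

instance instStandardBorelSpaceMatrix {m k : Type*} [Finite m] [Finite k] :
    StandardBorelSpace (Matrix m k ℝ) := by
  have := Fintype.ofFinite m
  have := Fintype.ofFinite k
  exact inferInstanceAs (StandardBorelSpace (m → k → ℝ))

instance instBorelSpaceMatrix {m k : Type*} [Finite m] [Finite k] :
    BorelSpace (Matrix m k ℝ) := by
  have := Fintype.ofFinite m
  have := Fintype.ofFinite k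
  exact inferInstanceAs (BorelSpace (m → k → ℝ))

instance instPolishSpaceMatrix {m k : Type*} [Finite m] [Finite k] :
    PolishSpace (Matrix m k ℝ) := by
  have := Fintype.ofFinite m
  have := Fintype.ofFinite k
  exact inferInstanceAs (PolishSpace (m → k → ℝ))

/-! ### Orthogonal matrices and equality of Gram matrices -/

section Orthogonal

/-- The linear isometry equivalence of Euclidean space given by an orthogonal matrix. -/
def orthIso {d : ℕ} (R : Matrix (Fin d) (Fin d) ℝ) (hR : Rᵀ * R = 1) :
    EuclideanSpace ℝ (Fin d) ≃ₗᵢ[ℝ] EuclideanSpace ℝ (Fin d) where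
  toFun x := WithLp.toLp 2 (R *ᵥ x.ofLp)
  invFun x := WithLp.toLp 2 (Rᵀ *ᵥ x.ofLp)
  map_add' x y := by ext; simp [Matrix.mulVec_add]
  map_smul' c x := by ext; simp [Matrix.mulVec_smul]
  left_inv x := by ext; simp [Matrix.mulVec_mulVec, hR]
  right_inv x := by ext; simp [Matrix.mulVec_mulVec, mul_eq_one_comm.mp hR]
  norm_map' x := by
    rw [← sq_eq_sq₀ (norm_nonneg _) (norm_nonneg _), ← real_inner_self_eq_norm_sq,
      ← real_inner_self_eq_norm_sq]
    simp only [EuclideanSpace.inner_eq_star_dotProduct, star_trivial, LinearEquiv.coe_mk,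
      LinearMap.coe_mk, AddHom.coe_mk]
    rw [Matrix.dotProduct_mulVec, Matrix.vecMul_mulVec, hR, Matrix.vecMul_one]

lemma orthIso_apply {d : ℕ} (R : Matrix (Fin d) (Fin d) ℝ) (hR : Rᵀ * R = 1)
    (x : EuclideanSpace ℝ (Fin d)) : orthIso R hR x = WithLp.toLp 2 (R *ᵥ x.ofLp) := rfl

/-- Two matrices with the same Gram matrix differ by an orthogonal matrix on the left. -/
lemma exists_orthogonal_mul_eq {d : ℕ} {k : Type*} [Fintype k] (A A' : Matrix (Fin d) k ℝ)
    (h : Aᵀ * A = A'ᵀ * A') :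
    ∃ R : Matrix (Fin d) (Fin d) ℝ, Rᵀ * R = 1 ∧ A = R * A' := by
  classical
  set f := Matrix.toEuclideanLin A' with hf
  set g := Matrix.toEuclideanLin A with hg
  have hfg : ∀ x, ‖g x‖ = ‖f x‖ := by
    intro x
    rw [← sq_eq_sq₀ (norm_nonneg _) (norm_nonneg _), ← real_inner_self_eq_norm_sq,
      ← real_inner_self_eq_norm_sq]
    simp only [EuclideanSpace.inner_eq_star_dotProduct, star_trivial, hf, hg,
      Matrix.ofLp_toLpLin, Matrix.toLin'_apply]
    rw [Matrix.dotProduct_mulVec, Matrix.vecMul_mulVec, h, Matrix.dotProduct_mulVec,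
      Matrix.vecMul_mulVec]
  have hker : LinearMap.ker f ≤ LinearMap.ker g := by
    intro x hx
    rw [LinearMap.mem_ker] at hx ⊢
    rw [← norm_eq_zero, hfg, hx, norm_zero]
  -- Equal Gram matrices give `‖A x‖ = ‖A' x‖`, so `A' x ↦ A x` is a well-defined isometry on the
  -- range of `A'`. Any isometric extension to the whole space supplies `R`.
  let L₀ : LinearMap.range f →ₗ[ℝ] EuclideanSpace ℝ (Fin d) :=
    (LinearMap.ker f).liftQ g hker ∘ₗ f.quotKerEquivRange.symm.toLinearMap
  have hL₀ : ∀ x, L₀ ⟨f x, LinearMap.mem_range_self f x⟩ = g x := by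
    intro x
    have : f.quotKerEquivRange.symm ⟨f x, LinearMap.mem_range_self f x⟩
        = Submodule.Quotient.mk x := by
      rw [LinearEquiv.symm_apply_eq]; rfl
    simp [L₀, this]
  let L : LinearMap.range f →ₗᵢ[ℝ] EuclideanSpace ℝ (Fin d) :=
    { L₀ with
      norm_map' := by
        rintro ⟨_, x, rfl⟩
        change ‖L₀ _‖ = _
        rw [hL₀, hfg]; rfl }
  let E := L.extend
  have hE : ∀ x, E (f x) = g x := by
    intro x
    have := L.extend_apply ⟨f x, LinearMap.mem_range_self f x⟩
    rw [← hL₀]; exact this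
  obtain ⟨R, hR⟩ := Matrix.toEuclideanLin.surjective E.toLinearMap
  have hRE : ∀ x : Fin d → ℝ, R *ᵥ x = (E (WithLp.toLp 2 x)).ofLp := by
    intro x
    have := congrArg (fun F => (F (WithLp.toLp 2 x)).ofLp) hR
    simpa using this
  refine ⟨R, ?_, ?_⟩
  · refine Matrix.ext_of_mulVec_single fun j => ?_
    refine funext fun i => ?_
    have h1 := E.inner_map_map (WithLp.toLp 2 (Pi.single j 1)) (WithLp.toLp 2 (Pi.single i 1))
    rw [EuclideanSpace.inner_eq_star_dotProduct, EuclideanSpace.inner_eq_star_dotProduct, ← hRE,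
      ← hRE] at h1
    rw [← Matrix.mulVec_mulVec, ← single_one_dotProduct i (Rᵀ *ᵥ _), Matrix.dotProduct_mulVec,
      Matrix.vecMul_transpose]
    simpa [dotProduct_comm, Matrix.one_apply, Pi.single_apply, eq_comm] using h1
  · refine Matrix.ext_of_mulVec_single fun j => ?_
    rw [← Matrix.mulVec_mulVec, hRE]
    have := congrArg WithLp.ofLp (hE (WithLp.toLp 2 (Pi.single j 1)))
    simp only [f, g, Matrix.toLpLin_toLp, Matrix.toLin'_apply] at this
    exact this.symm

end Orthogonal

/-! ### Gram-Schmidt frames: equivariance, orthonormality, measurability -/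

section Frame

variable {d r : ℕ}

/-- The recursion uses only linear combinations, inner products and norms, all compatible with `f`.
-/
lemma gramSchmidt_map_isometry {E : Type*} [NormedAddCommGroup E] [InnerProductSpace ℝ E]
    (f : E ≃ₗᵢ[ℝ] E) (v : Fin r → E) (k : Fin r) :
    InnerProductSpace.gramSchmidt ℝ (fun k => f (v k)) k
      = f (InnerProductSpace.gramSchmidt ℝ v k) := by
  induction k using WellFoundedLT.induction with
  | ind k ih =>
    rw [InnerProductSpace.gramSchmidt_def, InnerProductSpace.gramSchmidt_def, map_sub, map_sum]
    congr 1
    refine Finset.sum_congr rfl fun i hi => ?_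
    rw [ih i (Finset.mem_Iio.mp hi), Submodule.starProjection_singleton,
      Submodule.starProjection_singleton, map_smul, f.inner_map_map, f.norm_map]

lemma frame_map_orthIso (R : Matrix (Fin d) (Fin d) ℝ) (hR : Rᵀ * R = 1)
    (v : Fin r → EuclideanSpace ℝ (Fin d)) :
    frame (fun k => orthIso R hR (v k)) = R * frame v := by
  ext i k
  simp only [frame, Matrix.of_apply, InnerProductSpace.gramSchmidtNormed,
    gramSchmidt_map_isometry, LinearIsometryEquiv.norm_map]
  simp [orthIso_apply, Matrix.mul_apply, Matrix.mulVec, dotProduct, Finset.mul_sum,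
    mul_left_comm]

lemma frame_transpose_mul_self {v : Fin r → EuclideanSpace ℝ (Fin d)}
    (hv : LinearIndependent ℝ v) : (frame v)ᵀ * frame v = 1 := by
  ext i j
  have := (orthonormal_iff_ite.mp
    (InnerProductSpace.gramSchmidtNormed_orthonormal (𝕜 := ℝ) hv)) i j
  rw [Matrix.one_apply, ← this, EuclideanSpace.inner_eq_star_dotProduct]
  simp [frame, Matrix.mul_apply, dotProduct, mul_comm]

lemma measurable_gramSchmidt (k : Fin r) :
    Measurable fun v : Fin r → EuclideanSpace ℝ (Fin d) =>
      InnerProductSpace.gramSchmidt ℝ v k := by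
  induction k using WellFoundedLT.induction with
  | ind k ih =>
    have : (fun v : Fin r → EuclideanSpace ℝ (Fin d) => InnerProductSpace.gramSchmidt ℝ v k) =
        _ := funext fun v => InnerProductSpace.gramSchmidt_def ℝ v k
    rw [this]
    refine (measurable_pi_apply k).sub (Finset.measurable_fun_sum _ fun i hi => ?_)
    have hi := ih i (Finset.mem_Iio.mp hi)
    simp_rw [Submodule.starProjection_singleton]
    exact ((hi.inner (measurable_pi_apply k)).div (by simpa using! hi.norm.pow_const 2)).smul hi

lemma measurable_matrix_iff {α : Type*} [MeasurableSpace α] {m k : Type*}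
    {f : α → Matrix m k ℝ} : Measurable f ↔ ∀ i j, Measurable fun a => f a i j := by
  constructor
  · intro h i j
    exact (measurable_pi_apply j).comp ((measurable_pi_apply i).comp h)
  · intro h
    exact measurable_pi_lambda _ fun i => measurable_pi_lambda _ fun j => h i j

lemma measurable_frame :
    Measurable (frame : (Fin r → EuclideanSpace ℝ (Fin d)) → Matrix (Fin d) (Fin r) ℝ) := by
  refine measurable_matrix_iff.mpr fun i k => ?_
  simp only [frame, Matrix.of_apply, InnerProductSpace.gramSchmidtNormed]
  have h := measurable_gramSchmidt (d := d) k
  have h2 : Measurable fun v : Fin r → EuclideanSpace ℝ (Fin d) =>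
      ((‖InnerProductSpace.gramSchmidt ℝ v k‖ : ℝ)⁻¹ • InnerProductSpace.gramSchmidt ℝ v k) :=
    h.norm.inv.smul h
  exact (by fun_prop : Measurable fun x : EuclideanSpace ℝ (Fin d) => x i).comp h2

end Frame

/-! ### Measurability of matrix operations -/

section MatrixMeasurability

variable {α : Type*} [MeasurableSpace α]

lemma _root_.Measurable.matrix_mul {l m k : Type*} [Fintype m] {f : α → Matrix l m ℝ}
    {g : α → Matrix m k ℝ} (hf : Measurable f) (hg : Measurable g) :
    Measurable fun a => f a * g a := by
  refine measurable_matrix_iff.mpr fun i j => ?_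
  simp only [Matrix.mul_apply]
  exact Finset.measurable_fun_sum _ fun x _ =>
    (measurable_matrix_iff.mp hf i x).mul (measurable_matrix_iff.mp hg x j)

lemma _root_.Measurable.matrix_transpose {l m : Type*} {f : α → Matrix l m ℝ} (hf : Measurable f) :
    Measurable fun a => (f a)ᵀ :=
  measurable_matrix_iff.mpr fun i j => measurable_matrix_iff.mp hf j i

lemma _root_.Measurable.matrix_add {l m : Type*} {f g : α → Matrix l m ℝ} (hf : Measurable f)
    (hg : Measurable g) : Measurable fun a => f a + g a :=
  measurable_matrix_iff.mpr fun i j =>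
    (measurable_matrix_iff.mp hf i j).add (measurable_matrix_iff.mp hg i j)

lemma _root_.Measurable.matrix_submatrix {l m l' m' : Type*} {f : α → Matrix l m ℝ} (hf : Measurable f)
    (a : l' → l) (b : m' → m) : Measurable fun x => (f x).submatrix a b :=
  measurable_matrix_iff.mpr fun i j => measurable_matrix_iff.mp hf (a i) (b j)

lemma measurable_matrix_inv {m : Type*} [Fintype m] [DecidableEq m] :
    Measurable fun A : Matrix m m ℝ => A⁻¹ := by
  have hdet : Measurable fun A : Matrix m m ℝ => A.det := by
    have : Continuous fun A : Matrix m m ℝ => A.det := continuous_id.matrix_det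
    exact this.measurable
  have hadj : Measurable fun A : Matrix m m ℝ => A.adjugate := by
    have : Continuous fun A : Matrix m m ℝ => A.adjugate := continuous_id.matrix_adjugate
    exact this.measurable
  refine measurable_matrix_iff.mpr fun i j => ?_
  simp only [Matrix.inv_def, Ring.inverse_eq_inv', Matrix.smul_apply, smul_eq_mul]
  exact hdet.inv.mul (measurable_matrix_iff.mp hadj i j)

lemma measurable_hat {n s : ℕ} : Measurable (hat : Matrix (Fin n) (Fin s) ℝ → _) := by
  unfold hat
  exact Measurable.matrix_mul (Measurable.matrix_mul measurable_id (measurable_matrix_inv.comp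
    (Measurable.matrix_mul (Measurable.matrix_transpose measurable_id) measurable_id)))
    (Measurable.matrix_transpose measurable_id)

lemma isClosed_posSemidef {m : Type*} [Fintype m] :
    IsClosed {A : Matrix m m ℝ | A.PosSemidef} := by
  have : {A : Matrix m m ℝ | A.PosSemidef} =
      {A | Aᴴ = A} ∩ ⋂ x : m → ℝ, {A | 0 ≤ star x ⬝ᵥ A *ᵥ x} := by
    ext A
    simp [Matrix.posSemidef_iff_dotProduct_mulVec, Matrix.IsHermitian]
  rw [this]
  refine IsClosed.inter (isClosed_eq (by fun_prop) (by fun_prop)) (isClosed_iInter fun x => ?_)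
  exact isClosed_le continuous_const (by fun_prop)

/-- The square root of positive semidefinite matrices is measurable, as the inverse of an
injective continuous map. -/
lemma _root_.Measurable.matrix_sqrt {m : Type*} [Fintype m] [DecidableEq m] {f : α → Matrix m m ℝ}
    (hf : Measurable f) (h : ∀ a, (f a).PosSemidef) : Measurable fun a => CFC.sqrt (f a) := by
  set s := {A : Matrix m m ℝ | A.PosSemidef} with hs
  have hsq : ∀ A ∈ s, CFC.sqrt (A * A) = A := fun A hA =>
    CFC.sqrt_mul_self A (Matrix.nonneg_iff_posSemidef.mpr hA)
  -- Lusin-Souslin: an injective continuous map on a Borel subset of a standard Borel space is a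
  -- measurable embedding. Measurability of the root can then be tested after squaring, which gives
  -- back `f`.
  have hemb : MeasurableEmbedding (s.domRestrict fun A => A * A) := by
    refine ContinuousOn.measurableEmbedding isClosed_posSemidef.measurableSet
      (by fun_prop) ?_
    intro A hA B hB hAB
    rw [← hsq A hA, ← hsq B hB]
    exact congrArg _ hAB
  let g : α → s := fun a => ⟨CFC.sqrt (f a), Matrix.nonneg_iff_posSemidef.mp (CFC.sqrt_nonneg (f a))⟩
  have hg : Measurable g := by
    rw [← hemb.measurable_comp_iff]
    convert hf using 1
    ext1 a
    exact CFC.sqrt_mul_sqrt_self _ (h a).nonneg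
  exact measurable_subtype_coe.comp hg

end MatrixMeasurability

/-! ### Algebra of the hat matrix, residual frames and copies -/

section Algebra

variable {n s t : ℕ}

lemma hat_mul_self {Z : Matrix (Fin n) (Fin s) ℝ} (hZ : IsUnit (Zᵀ * Z)) : hat Z * Z = Z := by
  rw [hat, Matrix.mul_assoc, Matrix.mul_assoc,
    Matrix.nonsing_inv_mul _ ((Matrix.isUnit_iff_isUnit_det _).mp hZ), Matrix.mul_one]

lemma hat_transpose (Z : Matrix (Fin n) (Fin s) ℝ) : (hat Z)ᵀ = hat Z := by
  simp [hat, Matrix.transpose_mul, Matrix.transpose_nonsing_inv, Matrix.mul_assoc]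

lemma hat_mul_hat {Z : Matrix (Fin n) (Fin s) ℝ} (hZ : IsUnit (Zᵀ * Z)) :
    hat Z * hat Z = hat Z := by
  conv_lhs => rw [hat.eq_def Z, ← hat.eq_def Z]
  conv_lhs => arg 2; rw [hat]
  rw [← Matrix.mul_assoc, ← Matrix.mul_assoc, hat_mul_self hZ, ← hat]

variable {Z : Matrix (Fin n) (Fin s) ℝ} {P : Matrix (Fin (n - s)) (Fin n) ℝ}

/-- `P = (P Pᵀ) P = P (1 - hat Z)`, and `1 - hat Z` annihilates `Z`. -/
lemma IsResidualFrame.mul_eq_zero (h : IsResidualFrame Z P) (hZ : IsUnit (Zᵀ * Z)) :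
    P * Z = 0 := by
  have : P * Z = P * Pᵀ * P * Z := by rw [h.1, Matrix.one_mul]
  rw [this, Matrix.mul_assoc P, h.2, Matrix.mul_assoc, Matrix.sub_mul, Matrix.one_mul,
    hat_mul_self hZ, sub_self, Matrix.mul_zero]

lemma IsResidualFrame.mul_hat (h : IsResidualFrame Z P) (hZ : IsUnit (Zᵀ * Z)) :
    P * hat Z = 0 := by
  rw [hat, ← Matrix.mul_assoc, ← Matrix.mul_assoc, h.mul_eq_zero hZ, Matrix.zero_mul,
    Matrix.zero_mul]

lemma IsResidualFrame.hat_mul_transpose (h : IsResidualFrame Z P) (hZ : IsUnit (Zᵀ * Z)) :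
    hat Z * Pᵀ = 0 := by
  rw [← Matrix.transpose_inj, Matrix.transpose_mul, Matrix.transpose_transpose, hat_transpose,
    h.mul_hat hZ, Matrix.transpose_zero]

lemma posSemidef_residual_gram (P : Matrix (Fin (n - s)) (Fin n) ℝ) (W : Matrix (Fin n) (Fin t) ℝ) :
    (Wᵀ * Pᵀ * P * W).PosSemidef := by
  have := Matrix.posSemidef_conjTranspose_mul_self (P * W)
  rwa [Matrix.conjTranspose_eq_transpose_of_trivial, Matrix.transpose_mul, ← Matrix.mul_assoc] at this

lemma transpose_submatrix_cast_mul {a b : ℕ} (h : b = a) (A : Matrix (Fin a) (Fin t) ℝ) :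
    (A.submatrix (Fin.cast h) id)ᵀ * A.submatrix (Fin.cast h) id = Aᵀ * A := by
  subst h; simp

/-- Apart from measurability, this is all that is used about `Q`; the two cases of its definition
play no further role. -/
lemma qMatrix_gram (P : Matrix (Fin (n - s)) (Fin n) ℝ) (W : Matrix (Fin n) (Fin t) ℝ) :
    (qMatrix P W)ᵀ * qMatrix P W = Wᵀ * (Pᵀ * P) * W := by
  unfold qMatrix
  split_ifs with h
  · have h0 := posSemidef_residual_gram P W
    rw [transpose_submatrix_cast_mul, ← Matrix.conjTranspose_eq_transpose_of_trivial,
      (Matrix.nonneg_iff_posSemidef.mp (CFC.sqrt_nonneg (Wᵀ * Pᵀ * P * W))).isHermitian.eq,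
      CFC.sqrt_mul_sqrt_self _ h0.nonneg, Matrix.mul_assoc Wᵀ]
  · rw [transpose_submatrix_cast_mul, Matrix.transpose_mul, Matrix.mul_assoc, Matrix.mul_assoc,
      Matrix.mul_assoc]

lemma measurable_qMatrix {α : Type*} [MeasurableSpace α]
    {P : α → Matrix (Fin (n - s)) (Fin n) ℝ} {W : α → Matrix (Fin n) (Fin t) ℝ}
    (hP : Measurable P) (hW : Measurable W) : Measurable fun a => qMatrix (P a) (W a) := by
  unfold qMatrix
  split_ifs with h
  · refine Measurable.matrix_submatrix (Measurable.matrix_sqrt ?_ fun a =>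
      posSemidef_residual_gram _ _) _ _
    exact ((hW.matrix_transpose.matrix_mul hP.matrix_transpose).matrix_mul hP).matrix_mul hW
  · exact (hP.matrix_mul hW).matrix_submatrix _ _

lemma measurable_copy {α : Type*} [MeasurableSpace α]
    {Z : α → Matrix (Fin n) (Fin s) ℝ} {W : α → Matrix (Fin n) (Fin t) ℝ}
    {P : α → Matrix (Fin (n - s)) (Fin n) ℝ}
    {v : α → Fin (min (n - s) t) → EuclideanSpace ℝ (Fin (n - s))}
    (hZ : Measurable Z) (hW : Measurable W) (hP : Measurable P) (hv : Measurable v) :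
    Measurable fun a => copy (Z a) (W a) (P a) (v a) := by
  unfold copy
  exact ((measurable_hat.comp hZ).matrix_mul hW).matrix_add
    ((hP.matrix_transpose.matrix_mul (measurable_frame.comp hv)).matrix_mul
      (measurable_qMatrix hP hW))

lemma transpose_mul_eq_copy_transpose_mul (h : IsResidualFrame Z P) (hZ : IsUnit (Zᵀ * Z))
    (W : Matrix (Fin n) (Fin t) ℝ) (v : Fin (min (n - s) t) → EuclideanSpace ℝ (Fin (n - s))) :
    Wᵀ * Z = (copy Z W P v)ᵀ * Z := by
  simp only [copy, Matrix.transpose_add, Matrix.transpose_mul, Matrix.transpose_transpose,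
    hat_transpose, Matrix.add_mul, Matrix.mul_assoc, hat_mul_self hZ, h.mul_eq_zero hZ,
    Matrix.mul_zero, add_zero]

/-- The two summands of a copy have orthogonal column spaces, so the Gram matrices add; then `hat Z
+ Pᵀ P = 1`. -/
lemma transpose_mul_self_eq_copy (h : IsResidualFrame Z P) (hZ : IsUnit (Zᵀ * Z))
    (W : Matrix (Fin n) (Fin t) ℝ) {v : Fin (min (n - s) t) → EuclideanSpace ℝ (Fin (n - s))}
    (hv : LinearIndependent ℝ v) :
    Wᵀ * W = (copy Z W P v)ᵀ * copy Z W P v := by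
  have h1 : (copy Z W P v)ᵀ * copy Z W P v =
      Wᵀ * (hat Z * hat Z) * W + Wᵀ * (hat Z * Pᵀ) * (frame v * qMatrix P W)
      + (qMatrix P W)ᵀ * (frame v)ᵀ * (P * hat Z) * W
      + (qMatrix P W)ᵀ * ((frame v)ᵀ * (P * Pᵀ) * frame v) * qMatrix P W := by
    simp only [copy, Matrix.transpose_add, Matrix.transpose_mul, Matrix.transpose_transpose,
      hat_transpose, Matrix.add_mul, Matrix.mul_add, Matrix.mul_assoc]
    abel
  rw [h1, h.mul_hat hZ, h.hat_mul_transpose hZ, h.1, hat_mul_hat hZ, Matrix.mul_one,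
    frame_transpose_mul_self hv, Matrix.mul_one, qMatrix_gram, h.2]
  simp [Matrix.mul_sub, Matrix.sub_mul]

/-- The orthogonal matrix acting as the identity on the column space of `Z` and as `H` on its
orthogonal complement, parametrized by the frame `P`. -/
def residualRotation (Z : Matrix (Fin n) (Fin s) ℝ) (P : Matrix (Fin (n - s)) (Fin n) ℝ)
    (H : Matrix (Fin (n - s)) (Fin (n - s)) ℝ) : Matrix (Fin n) (Fin n) ℝ :=
  hat Z + Pᵀ * H * P

variable {H : Matrix (Fin (n - s)) (Fin (n - s)) ℝ}

/-- The cross terms contain `P * hat Z` or its transpose and vanish; the rest is `hat Z + Pᵀ P = 1`.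
-/
lemma residualRotation_orthogonal (h : IsResidualFrame Z P) (hZ : IsUnit (Zᵀ * Z))
    (hH : Hᵀ * H = 1) : (residualRotation Z P H)ᵀ * residualRotation Z P H = 1 := by
  have h1 : (residualRotation Z P H)ᵀ * residualRotation Z P H =
      hat Z * hat Z + (hat Z * Pᵀ) * (H * P) + Pᵀ * Hᵀ * (P * hat Z)
      + Pᵀ * (Hᵀ * (P * Pᵀ) * H) * P := by
    simp only [residualRotation, Matrix.transpose_add, Matrix.transpose_mul,
      Matrix.transpose_transpose, hat_transpose, Matrix.add_mul, Matrix.mul_add, Matrix.mul_assoc]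
    abel
  rw [h1, h.mul_hat hZ, h.hat_mul_transpose hZ, h.1, hat_mul_hat hZ, Matrix.mul_one, hH,
    Matrix.mul_one, h.2]
  simp

lemma residualRotation_mul_self (h : IsResidualFrame Z P) (hZ : IsUnit (Zᵀ * Z)) :
    residualRotation Z P H * Z = Z := by
  rw [residualRotation, Matrix.add_mul, hat_mul_self hZ, Matrix.mul_assoc, h.mul_eq_zero hZ,
    Matrix.mul_zero, add_zero]

lemma mul_residualRotation (h : IsResidualFrame Z P) (hZ : IsUnit (Zᵀ * Z)) :
    P * residualRotation Z P H = H * P := by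
  rw [residualRotation, Matrix.mul_add, h.mul_hat hZ, zero_add, ← Matrix.mul_assoc,
    ← Matrix.mul_assoc, h.1, Matrix.one_mul]

lemma hat_mul_residualRotation (h : IsResidualFrame Z P) (hZ : IsUnit (Zᵀ * Z)) :
    hat Z * residualRotation Z P H = hat Z := by
  rw [residualRotation, Matrix.mul_add, hat_mul_hat hZ, ← Matrix.mul_assoc, ← Matrix.mul_assoc,
    h.hat_mul_transpose hZ, Matrix.zero_mul, Matrix.zero_mul, add_zero]

/-- The inclusion of `ℝ^r` into `ℝ^d` as the first `r` coordinates. -/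
def coordFrame {r d : ℕ} (h : r ≤ d) : Matrix (Fin d) (Fin r) ℝ :=
  (1 : Matrix (Fin d) (Fin d) ℝ).submatrix id (Fin.castLE h)

lemma coordFrame_transpose_mul_self {r d : ℕ} (h : r ≤ d) :
    (coordFrame h)ᵀ * coordFrame h = 1 := by
  ext i j
  simp [coordFrame, Matrix.mul_apply, Matrix.one_apply, Fin.castLE_inj, eq_comm]

lemma exists_orthogonal_mul_coordFrame {r d : ℕ} (h : r ≤ d) (A : Matrix (Fin d) (Fin t) ℝ)
    (B : Matrix (Fin r) (Fin t) ℝ) (hAB : Aᵀ * A = Bᵀ * B) :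
    ∃ R : Matrix (Fin d) (Fin d) ℝ, Rᵀ * R = 1 ∧ A = R * (coordFrame h * B) := by
  refine exists_orthogonal_mul_eq A _ ?_
  rw [hAB, Matrix.transpose_mul, Matrix.mul_assoc, ← Matrix.mul_assoc _ _ B,
    coordFrame_transpose_mul_self, Matrix.one_mul]

end Algebra

/-! ### Almost sure linear independence -/

section LinearIndependent

/-- Independent random vectors which do not charge hyperplanes are almost surely linearly
independent. -/
lemma ae_linearIndependent_pi {d : ℕ} (r : ℕ) (hrd : r ≤ d)
    (ρ : Fin r → Measure (EuclideanSpace ℝ (Fin d))) [∀ i, IsProbabilityMeasure (ρ i)]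
    (hρ : ∀ i, ∀ a : EuclideanSpace ℝ (Fin d), a ≠ 0 → ρ i {x | inner ℝ a x = 0} = 0) :
    ∀ᵐ v ∂Measure.pi ρ, LinearIndependent ℝ v := by
  induction r with
  | zero => exact Filter.Eventually.of_forall fun v => linearIndependent_empty_type
  | succ r ih =>
    have hmeas (k : ℕ) :
        MeasurableSet {v : Fin k → EuclideanSpace ℝ (Fin d) | LinearIndependent ℝ v} :=
      isOpen_setOfPred_linearIndependent.measurableSet
    have hmp := measurePreserving_piFinSuccAbove ρ 0
    have key : ∀ᵐ y ∂(ρ 0).prod (Measure.pi fun j => ρ (Fin.succAbove 0 j)),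
        LinearIndependent ℝ ((MeasurableEquiv.piFinSuccAbove
          (fun _ => EuclideanSpace ℝ (Fin d)) 0).symm y) := by
      have hm : MeasurableSet {y | LinearIndependent ℝ ((MeasurableEquiv.piFinSuccAbove
          (fun _ : Fin (r + 1) => EuclideanSpace ℝ (Fin d)) 0).symm y)} :=
        (hmeas (r + 1)).preimage (MeasurableEquiv.measurable _)
      -- The order of integration is swapped so that the last `r` vectors `w` are fixed before the
      -- vector of index `0` is drawn.
      rw [← Measure.prod_swap, ae_map_iff measurable_swap.aemeasurable hm,
        Measure.ae_prod_iff_ae_ae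
          (p := fun x => LinearIndependent ℝ ((MeasurableEquiv.piFinSuccAbove
            (fun _ : Fin (r + 1) => EuclideanSpace ℝ (Fin d)) 0).symm x.swap))
          (hm.preimage measurable_swap)]
      filter_upwards [ih (by omega) (fun j => ρ (Fin.succAbove 0 j)) fun i => hρ _] with w hw
      -- Since `r < d`, the span of `w` is proper and has a nonzero normal vector `a`. Almost surely
      -- the new vector is not orthogonal to `a`, hence lies outside the span.
      have hspan : Submodule.span ℝ (Set.range w) ≠ ⊤ := by
        intro h
        have h1 := finrank_span_eq_card hw
        rw [h, finrank_top] at h1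
        simp at h1
        omega
      obtain ⟨a, ha, ha0⟩ := Submodule.exists_mem_ne_zero_of_ne_bot
        (fun h => hspan ((Submodule.orthogonal_eq_bot_iff).mp h))
      have h0 : ∀ᵐ x ∂ρ 0, ¬ inner ℝ a x = 0 := by
        rw [ae_iff]; simpa using hρ 0 a ha0
      filter_upwards [h0] with x hx
      have hcons : (MeasurableEquiv.piFinSuccAbove
          (fun _ : Fin (r + 1) => EuclideanSpace ℝ (Fin d)) 0).symm (w, x).swap = Fin.cons x w :=
        Fin.insertNth_zero' x w
      rw [hcons, linearIndependent_finCons]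
      refine ⟨hw, fun hmem => hx ?_⟩
      rw [real_inner_comm]
      exact (Submodule.mem_orthogonal _ _).mp ha x hmem
    have := hmp.quasiMeasurePreserving.ae key
    filter_upwards [this] with v hv
    rwa [MeasurableEquiv.symm_apply_apply] at hv

/-- `⟪a, x⟫` is a real Gaussian of variance `‖a‖ ^ 2 > 0`, so it has no atom at `0`. -/
lemma stdGaussian_hyperplane {d : ℕ} {a : EuclideanSpace ℝ (Fin d)} (ha : a ≠ 0) :
    stdGaussian (EuclideanSpace ℝ (Fin d)) {x | inner ℝ a x = 0} = 0 := by
  have h := IsGaussian.map_eq_gaussianReal (μ := stdGaussian (EuclideanSpace ℝ (Fin d)))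
    (innerSL ℝ a)
  rw [variance_dual_stdGaussian, innerSL_apply_norm] at h
  have : NullSingletonClass (gaussianReal
      (∫ x, innerSL ℝ a x ∂(stdGaussian (EuclideanSpace ℝ (Fin d)))) (‖a‖ ^ 2).toNNReal) :=
    nullSingletonClass_gaussianReal (by simpa using ha)
  have h2 := measure_singleton (μ := gaussianReal
      (∫ x, innerSL ℝ a x ∂(stdGaussian (EuclideanSpace ℝ (Fin d)))) (‖a‖ ^ 2).toNNReal) 0
  rw [← h, Measure.map_apply (by fun_prop) (measurableSet_singleton 0)] at h2
  exact h2

end LinearIndependent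

/-! ### Laws of random frames and rotations -/

section FrameLaw

/-- The law of `r` independent standard Gaussian vectors in `ℝ^d`. -/
abbrev gaussianVectors (r d : ℕ) : Measure (Fin r → EuclideanSpace ℝ (Fin d)) :=
  Measure.pi fun _ => stdGaussian (EuclideanSpace ℝ (Fin d))

lemma ae_linearIndependent_gaussianVectors {r d : ℕ} (h : r ≤ d) :
    ∀ᵐ v ∂gaussianVectors r d, LinearIndependent ℝ v :=
  ae_linearIndependent_pi r h _ fun _ _ ha => stdGaussian_hyperplane ha

/-- The law of the Gram-Schmidt frame of `r` independent standard Gaussian vectors in `ℝ^d`. -/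
def frameLaw (r d : ℕ) : Measure (Matrix (Fin d) (Fin r) ℝ) :=
  (gaussianVectors r d).map frame

/-- The law of the transposed Gram-Schmidt frame of `d` independent standard Gaussian vectors. -/
def rotationLaw (d : ℕ) : Measure (Matrix (Fin d) (Fin d) ℝ) :=
  (frameLaw d d).map Matrix.transpose

instance (r d : ℕ) : IsProbabilityMeasure (frameLaw r d) :=
  Measure.isProbabilityMeasure_map measurable_frame.aemeasurable

lemma measurable_transpose {m k : Type*} :
    Measurable (Matrix.transpose : Matrix m k ℝ → Matrix k m ℝ) :=
  measurable_id.matrix_transpose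

lemma measurable_mul_left {l m k : Type*} [Fintype m] (A : Matrix l m ℝ) :
    Measurable fun B : Matrix m k ℝ => A * B :=
  measurable_const.matrix_mul measurable_id

lemma measurable_mul_right {l m k : Type*} [Fintype m] (B : Matrix m k ℝ) :
    Measurable fun A : Matrix l m ℝ => A * B :=
  measurable_id.matrix_mul measurable_const

instance (d : ℕ) : IsProbabilityMeasure (rotationLaw d) :=
  Measure.isProbabilityMeasure_map measurable_transpose.aemeasurable

variable {r d : ℕ}

lemma measurableSet_matrix_eq {m k : Type*} [Finite m] [Finite k] {α : Type*} [MeasurableSpace α]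
    {f g : α → Matrix m k ℝ} (hf : Measurable f) (hg : Measurable g) :
    MeasurableSet {a | f a = g a} := measurableSet_eq_fun hf hg

lemma ae_frameLaw (h : r ≤ d) : ∀ᵐ U ∂frameLaw r d, Uᵀ * U = 1 := by
  rw [frameLaw, ae_map_iff measurable_frame.aemeasurable]
  · filter_upwards [ae_linearIndependent_gaussianVectors h] with v hv
    exact frame_transpose_mul_self hv
  · exact measurableSet_matrix_eq (measurable_transpose.matrix_mul measurable_id) measurable_const

lemma ae_rotationLaw : ∀ᵐ H ∂rotationLaw d, Hᵀ * H = 1 := by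
  rw [rotationLaw, ae_map_iff measurable_transpose.aemeasurable]
  · filter_upwards [ae_frameLaw (le_refl d)] with U hU
    rw [Matrix.transpose_transpose]
    exact mul_eq_one_comm.mp hU
  · exact measurableSet_matrix_eq (measurable_transpose.matrix_mul measurable_id) measurable_const

/-- Gram-Schmidt commutes with isometries and the standard Gaussian is invariant under them. -/
lemma frameLaw_map_mul (R : Matrix (Fin d) (Fin d) ℝ) (hR : Rᵀ * R = 1) :
    (frameLaw r d).map (fun U => R * U) = frameLaw r d := by
  have hmp : MeasurePreserving (fun (v : Fin r → EuclideanSpace ℝ (Fin d)) k => orthIso R hR (v k))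
      (gaussianVectors r d) (gaussianVectors r d) :=
    measurePreserving_pi _ _ fun _ => ⟨by fun_prop, stdGaussian_map _⟩
  rw [frameLaw, Measure.map_map (measurable_mul_left R) measurable_frame]
  have : (fun U => R * U) ∘ frame = frame ∘
      (fun (v : Fin r → EuclideanSpace ℝ (Fin d)) k => orthIso R hR (v k)) := by
    ext1 v; exact (frame_map_orthIso R hR v).symm
  rw [this, ← Measure.map_map measurable_frame hmp.measurable, hmp.map_eq]

/-- The transpose in `rotationLaw` serves this purpose: it turns left invariance of frames into
right invariance, so that `H` can absorb an orthogonal factor standing to its right. -/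
lemma rotationLaw_map_mul (R : Matrix (Fin d) (Fin d) ℝ) (hR : Rᵀ * R = 1) :
    (rotationLaw d).map (fun H => H * R) = rotationLaw d := by
  rw [rotationLaw, Measure.map_map (measurable_mul_right R) measurable_transpose]
  have : (fun H => H * R) ∘ Matrix.transpose = Matrix.transpose ∘
      fun U : Matrix (Fin d) (Fin d) ℝ => Rᵀ * U := by
    ext1 U; simp
  rw [this, ← Measure.map_map measurable_transpose (measurable_mul_left _),
    frameLaw_map_mul _ (by rw [Matrix.transpose_transpose]; exact mul_eq_one_comm.mp hR)]

lemma rotationLaw_map_mul_mul {t : ℕ} (R : Matrix (Fin d) (Fin d) ℝ) (hR : Rᵀ * R = 1)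
    (A : Matrix (Fin d) (Fin t) ℝ) :
    (rotationLaw d).map (fun H => H * (R * A)) = (rotationLaw d).map (fun H => H * A) := by
  have : (fun H : Matrix (Fin d) (Fin d) ℝ => H * (R * A)) = (fun H => H * A) ∘ fun H => H * R := by
    ext1 H; simp [Matrix.mul_assoc]
  rw [this, ← Measure.map_map (measurable_mul_right A) (measurable_mul_right R),
    rotationLaw_map_mul R hR]

/-- The law of the first `r` columns of a random rotation is that of a random frame. -/
lemma frameLaw_eq_rotationLaw_map (h : r ≤ d) :
    frameLaw r d = (rotationLaw d).map (fun H => H * coordFrame h) := by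
  -- Any `V` with orthonormal columns is an orthogonal matrix times `coordFrame h`, and right
  -- invariance absorbs that matrix.
  have hV : ∀ V : Matrix (Fin d) (Fin r) ℝ, Vᵀ * V = 1 →
      (rotationLaw d).map (fun H => H * V) = (rotationLaw d).map (fun H => H * coordFrame h) := by
    intro V hV
    obtain ⟨R, hR, hVR⟩ := exists_orthogonal_mul_coordFrame h V 1 (by rw [hV]; simp)
    rw [hVR, rotationLaw_map_mul_mul R hR, Matrix.mul_one]
  refine Measure.ext_of_lintegral _ fun f hf => ?_
  have hfm : Measurable fun x : Matrix (Fin d) (Fin d) ℝ × Matrix (Fin d) (Fin r) ℝ =>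
      f (x.1 * x.2) := hf.comp (measurable_fst.matrix_mul measurable_snd)
  -- Consider `H * U` with `H` and `U` independent. For fixed `H` it is distributed as `U`; for
  -- fixed `U` it is distributed as `H * coordFrame h`. Fubini equates the two laws.
  calc ∫⁻ U, f U ∂frameLaw r d
      = ∫⁻ _ : Matrix (Fin d) (Fin d) ℝ, ∫⁻ U, f U ∂frameLaw r d ∂rotationLaw d := by simp
    _ = ∫⁻ H, ∫⁻ U, f (H * U) ∂frameLaw r d ∂rotationLaw d := by
        refine lintegral_congr_ae ?_
        filter_upwards [ae_rotationLaw] with H hH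
        rw [← lintegral_map hf (measurable_mul_left H), frameLaw_map_mul H hH]
    _ = ∫⁻ U, ∫⁻ H, f (H * U) ∂rotationLaw d ∂frameLaw r d :=
        lintegral_lintegral_swap hfm.aemeasurable
    _ = ∫⁻ _ : Matrix (Fin d) (Fin r) ℝ,
          ∫⁻ H, f (H * coordFrame h) ∂rotationLaw d ∂frameLaw r d := by
        refine lintegral_congr_ae ?_
        filter_upwards [ae_frameLaw h] with U hU
        rw [← lintegral_map hf (measurable_mul_right U), hV U hU,
          lintegral_map hf (measurable_mul_right _)]
    _ = _ := by rw [lintegral_map hf (measurable_mul_right _)]; simp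

/-- Equality of Gram matrices gives `A = R * (coordFrame h * q)`; `H` absorbs `R`, and `H *
coordFrame h` is a random frame. -/
lemma rotationLaw_map_eq_frameLaw_map {t : ℕ} (h : r ≤ d) (A : Matrix (Fin d) (Fin t) ℝ)
    (q : Matrix (Fin r) (Fin t) ℝ) (hAq : Aᵀ * A = qᵀ * q) :
    (rotationLaw d).map (fun H => H * A) = (frameLaw r d).map (fun U => U * q) := by
  obtain ⟨R, hR, rfl⟩ := exists_orthogonal_mul_coordFrame h A q hAq
  rw [rotationLaw_map_mul_mul R hR, frameLaw_eq_rotationLaw_map h,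
    Measure.map_map (measurable_mul_right _) (measurable_mul_right _)]
  congr 1
  ext1 H
  simp [Matrix.mul_assoc]

/-- Both sides are the law of a full random rotation applied to `coordFrame h * q`. -/
lemma frameLaw_map_congr {t : ℕ} (h : r ≤ d) (q q' : Matrix (Fin r) (Fin t) ℝ)
    (hq : qᵀ * q = q'ᵀ * q') :
    (frameLaw r d).map (fun U => U * q) = (frameLaw r d).map (fun U => U * q') := by
  have hA : (coordFrame h * q)ᵀ * (coordFrame h * q) = qᵀ * q := by
    rw [Matrix.transpose_mul, Matrix.mul_assoc, ← Matrix.mul_assoc _ _ q,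
      coordFrame_transpose_mul_self, Matrix.one_mul]
  rw [← rotationLaw_map_eq_frameLaw_map h _ q hA,
    ← rotationLaw_map_eq_frameLaw_map h _ q' (hA.trans hq)]

end FrameLaw

/-! ### Ranks and the randomization p-value -/

section PValue

open Classical in
/-- The number of entries of a family of reals which are at least the `i`-th one. -/
def upperRank {k : ℕ} (x : Fin k → ℝ) (i : Fin k) : ℕ :=
  (Finset.univ.filter fun j => x i ≤ x j).card

lemma measurable_upperRank {k : ℕ} (i : Fin k) :
    Measurable fun x : Fin k → ℝ => upperRank x i := by
  classical
  simp only [upperRank, Finset.card_filter]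
  refine Finset.measurable_fun_sum _ fun j _ => Measurable.ite ?_ measurable_const measurable_const
  exact measurableSet_le (measurable_pi_apply i) (measurable_pi_apply j)

/-- Among the indices with rank at most `c`, take one with the smallest value. All the others lie
above it, so their number is at most its rank. Ties do no harm. -/
lemma card_upperRank_le {k : ℕ} (x : Fin k → ℝ) (c : ℝ) (hc : 0 ≤ c) :
    ((Finset.univ.filter fun i => (upperRank x i : ℝ) ≤ c).card : ℝ) ≤ c := by
  classical
  set G := Finset.univ.filter fun i => (upperRank x i : ℝ) ≤ c with hG
  rcases G.eq_empty_or_nonempty with h | h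
  · rw [h]; simpa using hc
  · obtain ⟨i, hi, hmin⟩ := G.exists_min_image x h
    have h1 : G.card ≤ upperRank x i :=
      Finset.card_le_card fun j hj => Finset.mem_filter.mpr ⟨Finset.mem_univ j, hmin j hj⟩
    exact (Nat.cast_le.mpr h1).trans (Finset.mem_filter.mp hi).2

/-- By exchangeability the `M + 1` events, one per index, have the same probability. At most `α * (M
+ 1)` of them occur at once, so their probabilities sum to at most that. -/
lemma pi_upperRank_le (ρ : Measure ℝ) [IsProbabilityMeasure ρ] (M : ℕ) {α : ℝ} (hα : 0 ≤ α) :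
    Measure.pi (fun _ : Fin (M + 1) => ρ) {x | (upperRank x 0 : ℝ) ≤ α * (M + 1)}
      ≤ ENNReal.ofReal α := by
  classical
  set μ := Measure.pi (fun _ : Fin (M + 1) => ρ)
  set A : Fin (M + 1) → Set (Fin (M + 1) → ℝ) := fun i => {x | (upperRank x i : ℝ) ≤ α * (M + 1)}
  have hA : ∀ i, MeasurableSet (A i) := fun i =>
    measurableSet_le (measurable_from_top.comp (measurable_upperRank i)) measurable_const
  have hsymm : ∀ i, μ (A i) = μ (A 0) := by
    intro i
    have hmp := measurePreserving_piCongrLeft (fun _ : Fin (M + 1) => ρ) (Equiv.swap 0 i)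
    rw [← hmp.measure_preimage (hA 0).nullMeasurableSet]
    congr 1
    ext x
    have : upperRank (MeasurableEquiv.piCongrLeft (fun _ => ℝ) (Equiv.swap 0 i) x) 0
        = upperRank x i := by
      have hx : ∀ j, MeasurableEquiv.piCongrLeft (fun _ => ℝ) (Equiv.swap 0 i) x j
          = x (Equiv.swap 0 i j) := by
        intro j
        have := Equiv.piCongrLeft_apply_apply (fun _ => ℝ) (Equiv.swap 0 i) x (Equiv.swap 0 i j)
        rw [Equiv.swap_apply_self] at this
        exact this
      unfold upperRank
      refine Finset.card_bij (fun j _ => Equiv.swap 0 i j) ?_ ?_ ?_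
      · intro j hj
        simpa [hx] using hj
      · intro a _ b _ hab
        simpa using hab
      · intro b hb
        exact ⟨Equiv.swap 0 i b, by simpa [hx] using hb, by simp⟩
    simp only [A, Set.mem_preimage, Set.mem_ofPred_eq, this]
  have hsum : ∑ i, μ (A i) ≤ ENNReal.ofReal (α * (M + 1)) := by
    calc ∑ i, μ (A i) = ∫⁻ x, ∑ i, (A i).indicator 1 x ∂μ := by
          rw [lintegral_finsetSum _ fun i _ => measurable_one.indicator (hA i)]
          simp [lintegral_indicator_one (hA _)]
      _ ≤ ∫⁻ _, ENNReal.ofReal (α * (M + 1)) ∂μ := by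
          refine lintegral_mono fun x => ?_
          have h1 := card_upperRank_le x (α * (M + 1)) (by positivity)
          have h2 : ∑ i, (A i).indicator (1 : (Fin (M + 1) → ℝ) → ENNReal) x =
              ((Finset.univ.filter fun i => (upperRank x i : ℝ) ≤ α * (M + 1)).card : ENNReal) := by
            simp [A, Set.indicator_apply]
          rw [h2, ← ENNReal.ofReal_natCast]
          exact ENNReal.ofReal_le_ofReal h1
      _ = _ := by simp
  simp only [hsymm, Finset.sum_const, Finset.card_univ, Fintype.card_fin, nsmul_eq_mul] at hsum
  rw [mul_comm α, ENNReal.ofReal_mul (by positivity)] at hsum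
  have h3 : ENNReal.ofReal ((M : ℝ) + 1) = ((M + 1 : ℕ) : ENNReal) := by
    rw [← ENNReal.ofReal_natCast]; push_cast; rfl
  rw [h3] at hsum
  exact (ENNReal.mul_le_mul_iff_right (by simp) (ENNReal.natCast_ne_top _)).mp hsum

/-- The leading `1` of the p-value is the observed statistic compared with itself. -/
lemma pVal_eq {M : ℕ} (x : Fin (M + 1) → ℝ) :
    pVal (x 0) (fun m => x m.succ) = upperRank x 0 / (M + 1) := by
  classical
  rw [pVal, upperRank, Finset.card_filter, Fin.sum_univ_succ]
  simp only [le_refl, if_true, ge_iff_le]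
  push_cast
  rw [one_div, inv_mul_eq_div]

lemma measurable_pVal {M : ℕ} :
    Measurable fun y : ℝ × (Fin M → ℝ) => pVal y.1 y.2 := by
  unfold pVal
  refine Measurable.const_mul (measurable_const.add (Finset.measurable_fun_sum _ fun m _ => ?_)) _
  exact Measurable.ite (measurableSet_le measurable_fst
    ((measurable_pi_apply m).comp measurable_snd)) measurable_const measurable_const

/-- The randomization p-value of i.i.d. statistics is super-uniform. -/
lemma prod_pi_pVal_le (ρ : Measure ℝ) [IsProbabilityMeasure ρ] (M : ℕ) {α : ℝ} (hα : 0 ≤ α) :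
    (ρ.prod (Measure.pi fun _ : Fin M => ρ)) {y | pVal y.1 y.2 ≤ α} ≤ ENNReal.ofReal α := by
  have hmp := measurePreserving_piFinSuccAbove (fun _ : Fin (M + 1) => ρ) 0
  refine le_trans (le_of_eq ?_) (pi_upperRank_le ρ M hα)
  rw [← hmp.measure_preimage (measurableSet_le measurable_pVal measurable_const).nullMeasurableSet]
  congr 1
  ext x
  have := pVal_eq x
  simp only [Set.mem_preimage, Set.mem_ofPred_eq]
  rw [← div_le_iff₀ (by positivity), ← this]
  rfl

end PValue

/-! ### The law of the copies and the conditional p-value bound -/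

section CopyLaw

variable {n s t : ℕ}

/-- The law of a copy of `W` given `Z`, `W` and `P`. -/
def copyLaw (Z : Matrix (Fin n) (Fin s) ℝ) (W : Matrix (Fin n) (Fin t) ℝ)
    (P : Matrix (Fin (n - s)) (Fin n) ℝ) : Measure (Matrix (Fin n) (Fin t) ℝ) :=
  (gaussianVectors (min (n - s) t) (n - s)).map (copy Z W P)

lemma measurable_copy_apply (Z : Matrix (Fin n) (Fin s) ℝ) (W : Matrix (Fin n) (Fin t) ℝ)
    (P : Matrix (Fin (n - s)) (Fin n) ℝ) : Measurable (copy Z W P) :=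
  measurable_copy measurable_const measurable_const measurable_const measurable_id

instance (Z : Matrix (Fin n) (Fin s) ℝ) (W : Matrix (Fin n) (Fin t) ℝ)
    (P : Matrix (Fin (n - s)) (Fin n) ℝ) : IsProbabilityMeasure (copyLaw Z W P) :=
  Measure.isProbabilityMeasure_map (measurable_copy_apply Z W P).aemeasurable

lemma measurable_affine {l m k : Type*} [Fintype m] (A : Matrix l k ℝ) (B : Matrix l m ℝ) :
    Measurable fun D : Matrix m k ℝ => A + B * D :=
  measurable_const.matrix_add (measurable_mul_left B)

/-- Isolates the factor `U Q`, whose law depends on `Q` only through its Gram matrix. -/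
lemma copyLaw_eq (Z : Matrix (Fin n) (Fin s) ℝ) (W : Matrix (Fin n) (Fin t) ℝ)
    (P : Matrix (Fin (n - s)) (Fin n) ℝ) :
    copyLaw Z W P = ((frameLaw (min (n - s) t) (n - s)).map (fun U => U * qMatrix P W)).map
      (fun D => hat Z * W + Pᵀ * D) := by
  rw [frameLaw, Measure.map_map (measurable_mul_right _) measurable_frame,
    Measure.map_map (measurable_affine _ _) ((measurable_mul_right _).comp measurable_frame)]
  refine congrArg (fun f => Measure.map f _) (funext fun v => ?_)
  simp only [MVNCRT.copy, Function.comp_apply, Matrix.mul_assoc]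

variable {Z : Matrix (Fin n) (Fin s) ℝ} {P P' : Matrix (Fin (n - s)) (Fin n) ℝ}

/-- The law of the copies does not depend on the choice of the residual frame. -/
lemma copyLaw_congr (h : IsResidualFrame Z P) (h' : IsResidualFrame Z P')
    (W : Matrix (Fin n) (Fin t) ℝ) : copyLaw Z W P = copyLaw Z W P' := by
  -- The two frames have the same row space, so this change of basis is orthogonal. Replacing `U` by
  -- `R * U` below cancels it.
  set R := P * P'ᵀ with hR
  have hRP : P = R * P' := by
    rw [hR, Matrix.mul_assoc, h'.2, ← h.2, ← Matrix.mul_assoc, h.1, Matrix.one_mul]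
  have hRR : Rᵀ * R = 1 := by
    have : Rᵀ * R = P' * (Pᵀ * P) * P'ᵀ := by
      simp [hR, Matrix.transpose_mul, Matrix.mul_assoc]
    rw [this, h.2, ← h'.2, ← Matrix.mul_assoc, h'.1, Matrix.one_mul, h'.1]
  have hq : (qMatrix P W)ᵀ * qMatrix P W = (qMatrix P' W)ᵀ * qMatrix P' W := by
    rw [qMatrix_gram, qMatrix_gram, h.2, h'.2]
  rw [copyLaw_eq, copyLaw_eq, frameLaw_map_congr (min_le_left _ _) _ _ hq]
  conv_lhs => rw [← frameLaw_map_mul R hRR]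
  rw [Measure.map_map (measurable_mul_right _) (measurable_mul_left _),
    Measure.map_map (measurable_affine _ _)
      ((measurable_mul_right _).comp (measurable_mul_left _)),
    Measure.map_map (measurable_affine _ _) (measurable_mul_right _)]
  refine congrArg (fun f => Measure.map f _) (funext fun U => ?_)
  simp only [Function.comp_apply]
  rw [show Pᵀ = P'ᵀ * Rᵀ by rw [hRP, Matrix.transpose_mul], Matrix.mul_assoc P'ᵀ,
    Matrix.mul_assoc R, ← Matrix.mul_assoc Rᵀ, hRR, Matrix.one_mul]

/-- The rotation leaves `hat Z * W` unchanged and turns `P * W` into `H * (P * W)`, which has the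
same Gram matrix. -/
lemma copyLaw_residualRotation (h : IsResidualFrame Z P) (hZ : IsUnit (Zᵀ * Z))
    {H : Matrix (Fin (n - s)) (Fin (n - s)) ℝ} (hH : Hᵀ * H = 1) (W : Matrix (Fin n) (Fin t) ℝ) :
    copyLaw Z (residualRotation Z P H * W) P = copyLaw Z W P := by
  have hq : (qMatrix P (residualRotation Z P H * W))ᵀ * qMatrix P (residualRotation Z P H * W)
      = (qMatrix P W)ᵀ * qMatrix P W := by
    have h1 : (residualRotation Z P H * W)ᵀ * (Pᵀ * P) * (residualRotation Z P H * W) =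
        Wᵀ * ((P * residualRotation Z P H)ᵀ * (P * residualRotation Z P H)) * W := by
      simp only [Matrix.transpose_mul, Matrix.mul_assoc]
    rw [qMatrix_gram, qMatrix_gram, h1, mul_residualRotation h hZ, Matrix.transpose_mul,
      Matrix.mul_assoc Pᵀ, ← Matrix.mul_assoc Hᵀ, hH, Matrix.one_mul]
  rw [copyLaw_eq, copyLaw_eq, frameLaw_map_congr (min_le_left _ _) _ _ hq, ← Matrix.mul_assoc,
    hat_mul_residualRotation h hZ]

lemma measurable_residualRotation (Z : Matrix (Fin n) (Fin s) ℝ)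
    (P : Matrix (Fin (n - s)) (Fin n) ℝ) : Measurable (residualRotation Z P) := by
  unfold residualRotation
  exact measurable_const.matrix_add
    ((measurable_const.matrix_mul measurable_id).matrix_mul measurable_const)

/-- Applying a random residual rotation to `W` has the same law as a copy of `W`. -/
lemma rotationLaw_map_residualRotation (Z : Matrix (Fin n) (Fin s) ℝ)
    (P : Matrix (Fin (n - s)) (Fin n) ℝ) (W : Matrix (Fin n) (Fin t) ℝ) :
    (rotationLaw (n - s)).map (fun H => residualRotation Z P H * W) = copyLaw Z W P := by
  rw [copyLaw_eq, ← rotationLaw_map_eq_frameLaw_map (min_le_left _ _) (P * W),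
    Measure.map_map (measurable_affine _ _) (measurable_mul_right _)]
  · congr 1
    ext1 H
    simp [residualRotation, Matrix.add_mul, Matrix.mul_assoc]
  · rw [qMatrix_gram, Matrix.transpose_mul]
    simp only [Matrix.mul_assoc]

lemma measurableSet_pVal_le {α : Type*} [MeasurableSpace α] {M : ℕ} {f : α → ℝ}
    {g : α → Fin M → ℝ} (hf : Measurable f) (hg : Measurable g) (a : ℝ) :
    MeasurableSet {x | pVal (f x) (g x) ≤ a} :=
  measurableSet_le (measurable_pVal.comp (hf.prodMk hg)) measurable_const

lemma pi_copy_pVal_eq (M : ℕ) {Φ : Matrix (Fin n) (Fin t) ℝ → ℝ} (hΦ : Measurable Φ)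
    (Z : Matrix (Fin n) (Fin s) ℝ) (P : Matrix (Fin (n - s)) (Fin n) ℝ)
    (W : Matrix (Fin n) (Fin t) ℝ) (c α : ℝ) :
    Measure.pi (fun _ : Fin M => gaussianVectors (min (n - s) t) (n - s))
        {v | pVal c (fun m => Φ (copy Z W P (v m))) ≤ α}
      = Measure.pi (fun _ : Fin M => copyLaw Z W P) {x | pVal c (fun m => Φ (x m)) ≤ α} := by
  have hmp : MeasurePreserving (fun (v : Fin M → _) m => copy Z W P (v m))
      (Measure.pi fun _ : Fin M => gaussianVectors (min (n - s) t) (n - s))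
      (Measure.pi fun _ : Fin M => copyLaw Z W P) :=
    measurePreserving_pi _ _ fun _ => ⟨measurable_copy_apply Z W P, rfl⟩
  rw [← hmp.measure_preimage]
  · rfl
  · exact (measurableSet_pVal_le measurable_const (measurable_pi_lambda _ fun m =>
      hΦ.comp (measurable_pi_apply m)) α).nullMeasurableSet

lemma prod_pi_pVal_comp_le {β : Type*} [MeasurableSpace β] (κ : Measure β)
    [IsProbabilityMeasure κ] (M : ℕ) {Φ : β → ℝ} (hΦ : Measurable Φ) {α : ℝ} (hα : 0 ≤ α) :
    (κ.prod (Measure.pi fun _ : Fin M => κ)) {y | pVal (Φ y.1) (fun m => Φ (y.2 m)) ≤ α}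
      ≤ ENNReal.ofReal α := by
  have : IsProbabilityMeasure (κ.map Φ) := Measure.isProbabilityMeasure_map hΦ.aemeasurable
  have hmp1 : MeasurePreserving Φ κ (κ.map Φ) := ⟨hΦ, rfl⟩
  have hmp2 : MeasurePreserving (fun (x : Fin M → β) m => Φ (x m)) (Measure.pi fun _ : Fin M => κ)
      (Measure.pi fun _ : Fin M => κ.map Φ) := measurePreserving_pi _ _ fun _ => hmp1
  refine le_trans (le_of_eq ?_) (prod_pi_pVal_le (κ.map Φ) M hα)
  rw [← (hmp1.prod hmp2).measure_preimage
    (measurableSet_pVal_le measurable_fst measurable_snd α).nullMeasurableSet]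
  rfl

/-- Conditionally on `Z`, and for a fixed residual frame, the p-value is super-uniform. -/
lemma lintegral_copy_pVal_le (h : IsResidualFrame Z P) (hZ : IsUnit (Zᵀ * Z))
    (ρ : Measure (Matrix (Fin n) (Fin t) ℝ)) [IsProbabilityMeasure ρ]
    (hρ : ∀ O : Matrix (Fin n) (Fin n) ℝ, Oᵀ * O = 1 → ρ.map (fun E => O * E) = ρ)
    (B : Matrix (Fin s) (Fin t) ℝ) (M : ℕ) {Φ : Matrix (Fin n) (Fin t) ℝ → ℝ} (hΦ : Measurable Φ)
    {α : ℝ} (hα : 0 ≤ α) :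
    ∫⁻ E, Measure.pi (fun _ : Fin M => gaussianVectors (min (n - s) t) (n - s))
        {v | pVal (Φ (Z * B + E)) (fun m => Φ (copy Z (Z * B + E) P (v m))) ≤ α} ∂ρ
      ≤ ENNReal.ofReal α := by
  set G : Matrix (Fin n) (Fin t) ℝ → ENNReal := fun W =>
    Measure.pi (fun _ : Fin M => gaussianVectors (min (n - s) t) (n - s))
        {v | pVal (Φ W) (fun m => Φ (copy Z W P (v m))) ≤ α} with hG
  have hGm : Measurable G := by
    have hset : MeasurableSet {y : Matrix (Fin n) (Fin t) ℝ × (Fin M → _) |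
        pVal (Φ y.1) (fun m => Φ (copy Z y.1 P (y.2 m))) ≤ α} := by
      refine measurableSet_pVal_le (hΦ.comp measurable_fst) (measurable_pi_lambda _ fun m => ?_) α
      exact hΦ.comp (measurable_copy measurable_const measurable_fst measurable_const
        ((measurable_pi_apply m).comp measurable_snd))
    exact measurable_measure_prodMk_left hset
  have hshift : Measurable fun E : Matrix (Fin n) (Fin t) ℝ => Z * B + E :=
    measurable_const.matrix_add measurable_id
  -- The residual rotation fixes `Z`, so it sends `Z * B + E` to `Z * B` plus a rotated `E`, and the
  -- law of `E` is rotation invariant.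
  have hinv : ∀ H : Matrix (Fin (n - s)) (Fin (n - s)) ℝ, Hᵀ * H = 1 →
      ∫⁻ E, G (Z * B + E) ∂ρ = ∫⁻ E, G (residualRotation Z P H * (Z * B + E)) ∂ρ := by
    intro H hH
    conv_lhs => rw [← hρ _ (residualRotation_orthogonal h hZ hH)]
    rw [lintegral_map (f := fun E => G (Z * B + E)) (hGm.comp hshift) (measurable_mul_left _)]
    simp only [Matrix.mul_add, ← Matrix.mul_assoc,
      residualRotation_mul_self h hZ]
  have hmeas2 : Measurable fun x : Matrix (Fin (n - s)) (Fin (n - s)) ℝ ×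
      Matrix (Fin n) (Fin t) ℝ => G (residualRotation Z P x.1 * (Z * B + x.2)) :=
    hGm.comp (((measurable_residualRotation Z P).comp measurable_fst).matrix_mul
      (hshift.comp measurable_snd))
  -- For fixed `W` and random `H`, the rotated block has law `κ`, and given `H` its copies are
  -- i.i.d. with this same `κ`. The observed statistic and its competitors are thus i.i.d.
  have hconst : ∀ W : Matrix (Fin n) (Fin t) ℝ,
      ∫⁻ H, G (residualRotation Z P H * W) ∂rotationLaw (n - s) ≤ ENNReal.ofReal α := by
    intro W
    set κ := copyLaw Z W P
    have hset : MeasurableSet {y : Matrix (Fin n) (Fin t) ℝ × (Fin M → Matrix (Fin n) (Fin t) ℝ) |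
        pVal (Φ y.1) (fun m => Φ (y.2 m)) ≤ α} :=
      measurableSet_pVal_le (hΦ.comp measurable_fst) (measurable_pi_lambda _ fun m =>
        hΦ.comp ((measurable_pi_apply m).comp measurable_snd)) α
    calc ∫⁻ H, G (residualRotation Z P H * W) ∂rotationLaw (n - s)
        = ∫⁻ H, Measure.pi (fun _ : Fin M => κ)
            {x | pVal (Φ (residualRotation Z P H * W)) (fun m => Φ (x m)) ≤ α}
            ∂rotationLaw (n - s) := by
          refine lintegral_congr_ae ?_
          filter_upwards [ae_rotationLaw] with H hH
          simp only [hG]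
          rw [pi_copy_pVal_eq M hΦ, copyLaw_residualRotation h hZ hH]
      _ = ∫⁻ W', Measure.pi (fun _ : Fin M => κ) {x | pVal (Φ W') (fun m => Φ (x m)) ≤ α} ∂κ := by
          have hκ : κ = _ := (rotationLaw_map_residualRotation Z P W).symm
          conv_rhs => enter [1]; rw [hκ]
          exact (lintegral_map (measurable_measure_prodMk_left hset)
            ((measurable_residualRotation Z P).matrix_mul measurable_const)).symm
      _ = (κ.prod (Measure.pi fun _ : Fin M => κ))
            {y | pVal (Φ y.1) (fun m => Φ (y.2 m)) ≤ α} := (Measure.prod_apply hset).symm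
      _ ≤ ENNReal.ofReal α := prod_pi_pVal_comp_le κ M hΦ hα
  calc ∫⁻ E, G (Z * B + E) ∂ρ
      = ∫⁻ _ : Matrix (Fin (n - s)) (Fin (n - s)) ℝ,
          ∫⁻ E, G (Z * B + E) ∂ρ ∂rotationLaw (n - s) := by simp
    _ = ∫⁻ H, ∫⁻ E, G (residualRotation Z P H * (Z * B + E)) ∂ρ ∂rotationLaw (n - s) := by
        refine lintegral_congr_ae ?_
        filter_upwards [ae_rotationLaw] with H hH
        exact hinv H hH
    _ = ∫⁻ E, ∫⁻ H, G (residualRotation Z P H * (Z * B + E)) ∂rotationLaw (n - s) ∂ρ :=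
        lintegral_lintegral_swap hmeas2.aemeasurable
    _ ≤ ∫⁻ _, ENNReal.ofReal α ∂ρ := lintegral_mono fun E => hconst _
    _ = ENNReal.ofReal α := by simp

end CopyLaw

/-! ### Matrices with i.i.d. Gaussian rows -/

section GaussianRows

variable {p : ℕ}

/-- Multiplication by a matrix, as a continuous linear map of Euclidean spaces. -/
def euclMap {k : ℕ} (J : Matrix (Fin k) (Fin p) ℝ) :
    EuclideanSpace ℝ (Fin p) →L[ℝ] EuclideanSpace ℝ (Fin k) :=
  (Matrix.toEuclideanLin J).toContinuousLinearMap

lemma euclMap_apply {k : ℕ} (J : Matrix (Fin k) (Fin p) ℝ) (x : EuclideanSpace ℝ (Fin p)) :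
    euclMap J x = WithLp.toLp 2 (J *ᵥ x.ofLp) := rfl

lemma inner_euclMap {k : ℕ} (J : Matrix (Fin k) (Fin p) ℝ) (a : EuclideanSpace ℝ (Fin k))
    (x : EuclideanSpace ℝ (Fin p)) : inner ℝ a (euclMap J x) = inner ℝ (euclMap Jᵀ a) x := by
  simp only [EuclideanSpace.inner_eq_star_dotProduct, euclMap_apply, star_trivial]
  rw [dotProduct_comm, Matrix.dotProduct_mulVec, ← Matrix.mulVec_transpose, dotProduct_comm]

variable {C : Matrix (Fin p) (Fin p) ℝ}

lemma covariance_euclMap {k l : ℕ} (hC : C.PosSemidef) (J : Matrix (Fin k) (Fin p) ℝ)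
    (K : Matrix (Fin l) (Fin p) ℝ) (a : EuclideanSpace ℝ (Fin k)) (b : EuclideanSpace ℝ (Fin l)) :
    cov[fun x => inner ℝ a (euclMap J x), fun x => inner ℝ b (euclMap K x);
      multivariateGaussian 0 C] = a.ofLp ⬝ᵥ (J * C * Kᵀ) *ᵥ b.ofLp := by
  simp only [inner_euclMap]
  rw [← covarianceBilin_apply_eq_cov IsGaussian.memLp_two_id,
    covarianceBilin_multivariateGaussian hC]
  simp only [euclMap_apply]
  rw [← Matrix.mulVec_mulVec, ← Matrix.mulVec_mulVec, Matrix.dotProduct_mulVec a.ofLp,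
    Matrix.mulVec_transpose J]

/-- The two images are jointly Gaussian with cross-covariance `J * C * Kᵀ`, and uncorrelated jointly
Gaussian vectors are independent. -/
lemma indepFun_euclMap {k l : ℕ} (hC : C.PosSemidef) {J : Matrix (Fin k) (Fin p) ℝ}
    {K : Matrix (Fin l) (Fin p) ℝ} (h : J * C * Kᵀ = 0) :
    IndepFun (euclMap J) (euclMap K) (multivariateGaussian 0 C) := by
  refine HasGaussianLaw.indepFun_of_covariance_inner ?_ fun a b => ?_
  · exact (IsGaussian.hasGaussianLaw_id (μ := multivariateGaussian 0 C)).map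
      ((euclMap J).prod (euclMap K))
  · rw [covariance_euclMap hC, h]
    simp

/-- `⟪a, J x⟫` is Gaussian with variance `aᵀ J C Jᵀ a > 0`, hence has no atom at `0`. -/
lemma map_euclMap_hyperplane {k : ℕ} (hC : C.PosSemidef) {J : Matrix (Fin k) (Fin p) ℝ}
    (hJ : (J * C * Jᵀ).PosDef) {a : EuclideanSpace ℝ (Fin k)} (ha : a ≠ 0) :
    (multivariateGaussian 0 C).map (euclMap J) {x | inner ℝ a x = 0} = 0 := by
  set N := multivariateGaussian 0 C
  have h := IsGaussian.map_eq_gaussianReal (μ := N) ((innerSL ℝ a).comp (euclMap J))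
  have hvar : 0 < Var[((innerSL ℝ a).comp (euclMap J)); N] := by
    have h1 := covariance_euclMap hC J J a a
    rw [covariance_self (by fun_prop)] at h1
    refine lt_of_lt_of_eq ?_ h1.symm
    have := hJ.dotProduct_mulVec_pos (x := a.ofLp) (by simpa using ha)
    simpa using this
  have : NullSingletonClass (gaussianReal (∫ x, ((innerSL ℝ a).comp (euclMap J)) x ∂N)
      (Var[((innerSL ℝ a).comp (euclMap J)); N]).toNNReal) :=
    nullSingletonClass_gaussianReal (by simpa using hvar)
  have h2 := measure_singleton (μ := gaussianReal (∫ x, ((innerSL ℝ a).comp (euclMap J)) x ∂N)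
      (Var[((innerSL ℝ a).comp (euclMap J)); N]).toNNReal) 0
  rw [← h, Measure.map_apply (by fun_prop) (measurableSet_singleton 0)] at h2
  have hset : MeasurableSet {x : EuclideanSpace ℝ (Fin k) | inner ℝ a x = 0} :=
    measurableSet_eq_fun (by fun_prop) measurable_const
  rw [Measure.map_apply (by fun_prop) hset]
  exact h2

/-- The centered Gaussian law with covariance `C`, on functions. -/
def rowGaussian (C : Matrix (Fin p) (Fin p) ℝ) : Measure (Fin p → ℝ) :=
  (multivariateGaussian 0 C).map WithLp.ofLp

instance : IsProbabilityMeasure (rowGaussian C) :=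
  Measure.isProbabilityMeasure_map (by fun_prop)

/-- The law of an `n × p` matrix with i.i.d. centered Gaussian rows with covariance `C`. -/
def matrixGaussian (n : ℕ) (C : Matrix (Fin p) (Fin p) ℝ) : Measure (Matrix (Fin n) (Fin p) ℝ) :=
  (Measure.pi fun _ : Fin n => rowGaussian C : Measure (Fin n → Fin p → ℝ))

instance (n : ℕ) : IsProbabilityMeasure (matrixGaussian n C) :=
  inferInstanceAs (IsProbabilityMeasure (Measure.pi fun _ : Fin n => rowGaussian C))

lemma measurable_mulVec {k : ℕ} (J : Matrix (Fin k) (Fin p) ℝ) :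
    Measurable fun x : Fin p → ℝ => J *ᵥ x :=
  (Continuous.matrix_mulVec continuous_const continuous_id).measurable

lemma rowGaussian_map_prod {k l : ℕ} (hC : C.PosSemidef) {J : Matrix (Fin k) (Fin p) ℝ}
    {K : Matrix (Fin l) (Fin p) ℝ} (h : J * C * Kᵀ = 0) :
    (rowGaussian C).map (fun x => (J *ᵥ x, K *ᵥ x))
      = ((rowGaussian C).map fun x => J *ᵥ x).prod ((rowGaussian C).map fun x => K *ᵥ x) := by
  have hind := (indepFun_euclMap hC h).comp (φ := WithLp.ofLp) (ψ := WithLp.ofLp)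
    (by fun_prop) (by fun_prop)
  have := (indepFun_iff_map_prod_eq_prod_map_map (by fun_prop) (by fun_prop)).mp hind
  have hof : Measurable (WithLp.ofLp : EuclideanSpace ℝ (Fin p) → Fin p → ℝ) := by fun_prop
  rw [rowGaussian, Measure.map_map ((measurable_mulVec J).prodMk (measurable_mulVec K)) hof,
    Measure.map_map (measurable_mulVec J) hof, Measure.map_map (measurable_mulVec K) hof]
  exact this

lemma mul_transpose_row {n k : ℕ} (X : Matrix (Fin n) (Fin p) ℝ) (J : Matrix (Fin k) (Fin p) ℝ)
    (i : Fin n) : (X * Jᵀ) i = J *ᵥ X i := by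
  ext j
  simp [Matrix.mul_apply, Matrix.mulVec, dotProduct, mul_comm]

lemma matrixGaussian_map_mul_transpose {n k : ℕ} (J : Matrix (Fin k) (Fin p) ℝ) :
    (matrixGaussian n C).map (fun X => X * Jᵀ)
      = (Measure.pi fun _ : Fin n => (rowGaussian C).map fun x => J *ᵥ x :
          Measure (Fin n → Fin k → ℝ)) := by
  have : ∀ _ : Fin n, IsProbabilityMeasure ((rowGaussian C).map fun x => J *ᵥ x) := fun _ =>
    Measure.isProbabilityMeasure_map (measurable_mulVec J).aemeasurable
  rw [← Measure.pi_map_pi fun _ => (measurable_mulVec J).aemeasurable]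
  refine congrArg (fun f => Measure.map f (matrixGaussian n C)) (funext fun X => funext fun i => ?_)
  exact mul_transpose_row X J i

/-- Uncorrelated linear images of a matrix with i.i.d. Gaussian rows are independent. -/
lemma matrixGaussian_map_prod {n k l : ℕ} (hC : C.PosSemidef) {J : Matrix (Fin k) (Fin p) ℝ}
    {K : Matrix (Fin l) (Fin p) ℝ} (h : J * C * Kᵀ = 0) :
    (matrixGaussian n C).map (fun X => (X * Jᵀ, X * Kᵀ))
      = ((matrixGaussian n C).map fun X => X * Jᵀ).prod
        ((matrixGaussian n C).map fun X => X * Kᵀ) := by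
  have h1 : IsProbabilityMeasure ((rowGaussian C).map fun x => J *ᵥ x) :=
    Measure.isProbabilityMeasure_map (measurable_mulVec J).aemeasurable
  have h2 : IsProbabilityMeasure ((rowGaussian C).map fun x => K *ᵥ x) :=
    Measure.isProbabilityMeasure_map (measurable_mulVec K).aemeasurable
  have hmp1 : MeasurePreserving (fun (X : Fin n → Fin p → ℝ) i => (J *ᵥ X i, K *ᵥ X i))
      (Measure.pi fun _ => rowGaussian C) _ :=
    measurePreserving_pi _ (fun _ : Fin n => ((rowGaussian C).map fun x => J *ᵥ x).prod
      ((rowGaussian C).map fun x => K *ᵥ x)) fun _ =>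
      ⟨(measurable_mulVec J).prodMk (measurable_mulVec K), rowGaussian_map_prod hC h⟩
  have hmp := (measurePreserving_arrowProdEquivProdArrow _ _ (Fin n)
    (fun _ => (rowGaussian C).map fun x => J *ᵥ x)
    (fun _ => (rowGaussian C).map fun x => K *ᵥ x)).comp hmp1
  rw [matrixGaussian_map_mul_transpose, matrixGaussian_map_mul_transpose]
  refine Eq.trans ?_ hmp.map_eq
  refine congrArg (fun f => Measure.map f (matrixGaussian n C)) (funext fun X => ?_)
  refine Prod.ext (funext fun i => mul_transpose_row X J i) (funext fun i => mul_transpose_row X K i)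

/-- Families of rows, with the Euclidean norm. -/
abbrev RowSpace (n p : ℕ) := PiLp 2 fun _ : Fin n => EuclideanSpace ℝ (Fin p)

/-- The exponents of the rows add up to a trace, a form in which invariance under `A ↦ Oᵀ * A` is
visible. Characteristic functions also cover singular `C`. -/
lemma pi_multivariateGaussian_charFun {n : ℕ} (hC : C.PosSemidef)
    (A : Matrix (Fin n) (Fin p) ℝ) :
    charFun ((Measure.pi fun _ : Fin n => multivariateGaussian 0 C).map (WithLp.toLp 2))
      (WithLp.toLp 2 fun i => WithLp.toLp 2 (A i))
      = Complex.exp (-((A * C * Aᵀ).trace : ℂ) / 2) := by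
  rw [charFun_pi]
  simp only [charFun_multivariateGaussian hC, inner_zero_right, Complex.ofReal_zero, zero_mul,
    zero_sub]
  rw [← Complex.exp_sum]
  congr 1
  rw [Finset.sum_neg_distrib, ← Finset.sum_div, neg_div, Matrix.trace]
  push_cast
  congr 2
  refine Finset.sum_congr rfl fun i _ => ?_
  congr 1
  rw [Matrix.dotProduct_mulVec]
  rfl

/-- The law of a matrix with i.i.d. centered Gaussian rows is invariant under rotations of the
columns. -/
lemma matrixGaussian_map_orthogonal {n : ℕ} (hC : C.PosSemidef) (O : Matrix (Fin n) (Fin n) ℝ)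
    (hO : Oᵀ * O = 1) : (matrixGaussian n C).map (fun X => O * X) = matrixGaussian n C := by
  set ν := Measure.pi fun _ : Fin n => multivariateGaussian (0 : EuclideanSpace ℝ (Fin p)) C with hν
  let f : (Fin n → EuclideanSpace ℝ (Fin p)) → Fin n → EuclideanSpace ℝ (Fin p) :=
    fun g i => ∑ k, O i k • g k
  have hf : Measurable f := by fun_prop
  have hof : MeasurePreserving (fun (g : Fin n → EuclideanSpace ℝ (Fin p)) =>
      Matrix.of fun i => (g i).ofLp) ν
      (matrixGaussian n C) :=
    measurePreserving_pi _ (fun _ : Fin n => rowGaussian C) fun _ => ⟨by fun_prop, rfl⟩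
  have key : ν.map f = ν := by
    have hto : Measurable (WithLp.toLp 2 : (Fin n → EuclideanSpace ℝ (Fin p)) →
      RowSpace n p) := WithLp.measurable_toLp 2 _
    have hl : (ν.map f).map (WithLp.toLp 2 : _ → RowSpace n p)
        = ν.map (WithLp.toLp 2) := by
      have : IsProbabilityMeasure (ν.map f) := Measure.isProbabilityMeasure_map hf.aemeasurable
      have : IsProbabilityMeasure ((ν.map f).map (WithLp.toLp 2 : _ → RowSpace n p)) :=
        Measure.isProbabilityMeasure_map hto.aemeasurable
      have : IsProbabilityMeasure (ν.map (WithLp.toLp 2 : _ → RowSpace n p)) :=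
        Measure.isProbabilityMeasure_map hto.aemeasurable
      refine Measure.ext_of_charFun (funext fun T => ?_)
      set A : Matrix (Fin n) (Fin p) ℝ := Matrix.of fun i => (T i).ofLp
      have hT : T = WithLp.toLp 2 fun i => WithLp.toLp 2 (A i) := rfl
      -- Rotating the random rows by `O` amounts to rotating the argument by `Oᵀ`.
      have hstep : charFun ((ν.map f).map (WithLp.toLp 2)) T
          = charFun (ν.map (WithLp.toLp 2))
            (WithLp.toLp 2 fun i => WithLp.toLp 2 ((Oᵀ * A) i)) := by
        rw [charFun_apply, charFun_apply, Measure.map_map hto hf,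
          integral_map (hto.comp hf).aemeasurable (by fun_prop),
          integral_map hto.aemeasurable (by fun_prop)]
        refine integral_congr_ae (Filter.Eventually.of_forall fun g => ?_)
        simp only [Function.comp_apply]
        congr 3
        have hrow : ∀ k, (WithLp.toLp 2 ((Oᵀ * A) k) : EuclideanSpace ℝ (Fin p))
            = ∑ i, O i k • T i := by
          intro k
          ext j
          simp [A, Matrix.mul_apply]
        rw [PiLp.inner_apply, PiLp.inner_apply]
        simp only [hrow, f, sum_inner, inner_sum, inner_smul_left, inner_smul_right]
        exact Finset.sum_comm
      rw [hstep, hT, pi_multivariateGaussian_charFun hC, pi_multivariateGaussian_charFun hC]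
      have : (Oᵀ * A * C * (Oᵀ * A)ᵀ).trace = (A * C * Aᵀ).trace := by
        rw [Matrix.transpose_mul, Matrix.transpose_transpose, ← Matrix.mul_assoc,
          Matrix.trace_mul_comm, ← Matrix.mul_assoc, ← Matrix.mul_assoc, ← Matrix.mul_assoc,
          mul_eq_one_comm.mp hO, Matrix.one_mul]
      rw [this]
    have := congrArg (Measure.map (WithLp.ofLp : (RowSpace n p) → _)) hl
    rwa [Measure.map_map (WithLp.measurable_ofLp 2 _) hto,
      Measure.map_map (WithLp.measurable_ofLp 2 _) hto,
      show (WithLp.ofLp : (RowSpace n p) → _) ∘ WithLp.toLp 2 = id from rfl,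
      Measure.map_id, Measure.map_id] at this
  rw [← hof.map_eq, Measure.map_map (measurable_mul_left O) hof.measurable]
  conv_rhs => rw [← key, Measure.map_map hof.measurable hf]
  congr 1
  funext g
  ext i j
  simp [f, Matrix.mul_apply]

end GaussianRows

/-! ### Almost sure invertibility of the Gram matrix -/

section GaussianMatrix

variable {Ω : Type*} [MeasurableSpace Ω] {μ : Measure Ω} [IsProbabilityMeasure μ] {n p : ℕ}
  {C : Matrix (Fin p) (Fin p) ℝ} {X : Ω → Matrix (Fin n) (Fin p) ℝ}

lemma map_eq_matrixGaussian (hX : Measurable X)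
    (hXlaw : ∀ i, HasLaw (fun ω => WithLp.toLp 2 (X ω i)) (multivariateGaussian 0 C) μ)
    (hXindep : iIndepFun (fun i ω => X ω i) μ) : μ.map X = matrixGaussian n C := by
  have hXi : ∀ i, Measurable fun ω => X ω i := fun i => (measurable_pi_apply i).comp hX
  have h := (iIndepFun_iff_map_fun_eq_pi_map fun i => (hXi i).aemeasurable).mp hXindep
  refine h.trans (congrArg (Measure.pi : (Fin n → Measure (Fin p → ℝ)) → _) (funext fun i => ?_))
  rw [rowGaussian, ← (hXlaw i).map_eq, Measure.map_map (by fun_prop) (by fun_prop)]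
  rfl

/-- The first `k` rows span the whole space, so `Z a = 0` makes `a` orthogonal to everything. Thus
`Z` is injective and `Zᵀ * Z` positive definite. -/
lemma isUnit_gram_of_linearIndependent {k : ℕ} (Z : Matrix (Fin n) (Fin k) ℝ) (hkn : k ≤ n)
    (h : LinearIndependent ℝ fun i : Fin k => WithLp.toLp 2 (Z (Fin.castLE hkn i))) :
    IsUnit (Zᵀ * Z) := by
  have hinj : Function.Injective Z.mulVec := by
    refine (injective_iff_map_eq_zero (Matrix.mulVecLin Z)).mpr ?_
    intro a ha
    have hspan := h.span_eq_top_of_card_eq_finrank' (by simp)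
    have : WithLp.toLp 2 a ∈ (Submodule.span ℝ
        (Set.range fun i : Fin k => WithLp.toLp 2 (Z (Fin.castLE hkn i))))ᗮ := by
      rw [Submodule.mem_orthogonal]
      intro u hu
      induction hu using Submodule.span_induction with
      | mem x hx =>
        obtain ⟨i, rfl⟩ := hx
        have := congrFun ha (Fin.castLE hkn i)
        simpa [EuclideanSpace.inner_eq_star_dotProduct, Matrix.mulVec, dotProduct_comm] using this
      | zero => simp
      | add x y _ _ hx hy => rw [inner_add_left, hx, hy, add_zero]
      | smul c x _ hx => rw [inner_smul_left, hx, mul_zero]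
    rw [hspan, Submodule.top_orthogonal_eq_bot, Submodule.mem_bot] at this
    exact congrArg WithLp.ofLp this
  have := (Matrix.PosDef.conjTranspose_mul_self Z hinj).isUnit
  rwa [Matrix.conjTranspose_eq_transpose_of_trivial] at this

/-- The first `k ≤ n` rows of `X * Jᵀ` are independent with nondegenerate covariance `J * C * Jᵀ`,
so they charge no hyperplane. -/
lemma ae_isUnit_gram {k : ℕ} (hC : C.PosSemidef) (hkn : k ≤ n) {J : Matrix (Fin k) (Fin p) ℝ}
    (hJ : (J * C * Jᵀ).PosDef) (hX : Measurable X)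
    (hXlaw : ∀ i, HasLaw (fun ω => WithLp.toLp 2 (X ω i)) (multivariateGaussian 0 C) μ)
    (hXindep : iIndepFun (fun i ω => X ω i) μ) :
    ∀ᵐ ω ∂μ, IsUnit ((X ω * Jᵀ)ᵀ * (X ω * Jᵀ)) := by
  have hXi : ∀ i, Measurable fun ω => X ω i := fun i => (measurable_pi_apply i).comp hX
  let R : Fin k → Ω → EuclideanSpace ℝ (Fin k) := fun i ω =>
    euclMap J (WithLp.toLp 2 (X ω (Fin.castLE hkn i)))
  have hR : ∀ i, Measurable (R i) := fun i => by fun_prop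
  have hind : iIndepFun R μ :=
    (hXindep.precomp (Fin.castLE_injective hkn)).comp
      (fun _ x => euclMap J (WithLp.toLp 2 x)) fun _ => by fun_prop
  have hmap := (iIndepFun_iff_map_fun_eq_pi_map fun i => (hR i).aemeasurable).mp hind
  have hlaw : ∀ i, μ.map (R i) = (multivariateGaussian 0 C).map (euclMap J) := by
    intro i
    rw [← (hXlaw (Fin.castLE hkn i)).map_eq, Measure.map_map (by fun_prop) (by fun_prop)]
    rfl
  have hp : ∀ i, IsProbabilityMeasure (μ.map (R i)) := fun i =>
    Measure.isProbabilityMeasure_map (hR i).aemeasurable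
  have hae := ae_linearIndependent_pi k le_rfl (fun i => μ.map (R i)) fun i a ha => by
    rw [hlaw]; exact map_euclMap_hyperplane hC hJ ha
  rw [← hmap] at hae
  filter_upwards [ae_of_ae_map (measurable_pi_lambda _ hR).aemeasurable hae] with ω hω
  refine isUnit_gram_of_linearIndependent _ hkn ?_
  convert hω using 2 with i
  exact congrArg _ (mul_transpose_row _ _ _)

end GaussianMatrix

/-! ### Conditional probabilities and conditional independence -/

section Conditioning

variable {Ω α β γ δ : Type*} [mΩ : MeasurableSpace Ω] [MeasurableSpace α] [mβ : MeasurableSpace β]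
  [MeasurableSpace γ] [MeasurableSpace δ] {μ : Measure Ω} [IsProbabilityMeasure μ]

/-- The conditional probability of an event about `Z` and an independent variable `E`. -/
lemma condProb_of_indepFun {Z : Ω → β} {E : Ω → γ} (hZ : Measurable Z) (hE : Measurable E)
    (hZE : IndepFun Z E μ) {D : Set (β × γ)} (hD : MeasurableSet D) :
    (fun ω => ((μ.map E).real (Prod.mk (Z ω) ⁻¹' D))) =ᵐ[μ]
      μ⟦(fun ω => (Z ω, E ω)) ⁻¹' D | mβ.comap Z⟧ := by
  have : IsProbabilityMeasure (μ.map E) := Measure.isProbabilityMeasure_map hE.aemeasurable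
  have : IsProbabilityMeasure (μ.map Z) := Measure.isProbabilityMeasure_map hZ.aemeasurable
  have hk : Measurable fun z => (μ.map E).real (Prod.mk z ⁻¹' D) :=
    (measurable_measure_prodMk_left hD).ennreal_toReal
  have hpair : MeasurableSet ((fun ω => (Z ω, E ω)) ⁻¹' D) := (hZ.prodMk hE) hD
  have hkint : Integrable (fun z => (μ.map E).real (Prod.mk z ⁻¹' D)) (μ.map Z) :=
    Integrable.of_bound hk.aestronglyMeasurable 1 (Filter.Eventually.of_forall fun z => by
      rw [Real.norm_of_nonneg measureReal_nonneg]; exact measureReal_le_one)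
  refine ae_eq_condExp_of_forall_setIntegral_eq hZ.comap_le
    ((integrable_const 1).indicator hpair) ?_ ?_ ?_
  · intro s _ _
    exact ((integrable_map_measure hk.aestronglyMeasurable hZ.aemeasurable).mp hkint).integrableOn
  · rintro _ ⟨S, hS, rfl⟩ -
    rw [← setIntegral_map hS hk.aestronglyMeasurable hZ.aemeasurable,
      integral_indicator_const _ hpair, measureReal_restrict_apply hpair]
    -- Intersecting with an event about `Z` gives again an event about `(Z, E)`, so Fubini for the
    -- product law evaluates its probability.
    have h1 : (fun ω => (Z ω, E ω)) ⁻¹' D ∩ Z ⁻¹' S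
        = (fun ω => (Z ω, E ω)) ⁻¹' (D ∩ S ×ˢ Set.univ) := by
      ext ω; simp
    have h2 : MeasurableSet (D ∩ S ×ˢ (Set.univ : Set γ)) := hD.inter (hS.prod MeasurableSet.univ)
    rw [h1, ← map_measureReal_apply (hZ.prodMk hE) h2,
      (indepFun_iff_map_prod_eq_prod_map_map hZ.aemeasurable hE.aemeasurable).mp hZE,
      measureReal_def, Measure.prod_apply h2, smul_eq_mul, mul_one, ← integral_indicator hS,
      ← integral_toReal (measurable_measure_prodMk_left h2).aemeasurable
        (Filter.Eventually.of_forall fun _ => measure_lt_top _ _)]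
    refine integral_congr_ae (Filter.Eventually.of_forall fun z => ?_)
    by_cases hz : z ∈ S
    · simp [hz, Set.indicator_of_mem, measureReal_def]
    · simp [hz]
  · exact (hk.comp (comap_measurable Z)).aestronglyMeasurable

/-- If `Y` and `W = f (Z, E)` are conditionally independent given `Z`, with `E` independent of
`Z`, then `(Y, Z, W)` has the law of `(Y, Z, f (Z, E'))` with `E'` independent of `(Y, Z)`. -/
lemma CondIndepGiven.map_eq {Y : Ω → α} {Z : Ω → β} {E : Ω → γ} {f : β × γ → δ}
    (hY : Measurable Y) (hZ : Measurable Z) (hE : Measurable E) (hf : Measurable f)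
    (hZE : IndepFun Z E μ) (h : CondIndepGiven Y (fun ω => f (Z ω, E ω)) Z μ) :
    μ.map (fun ω => ((Y ω, Z ω), f (Z ω, E ω)))
      = ((μ.map fun ω => (Y ω, Z ω)).prod (μ.map E)).map fun x => (x.1, f (x.1.2, x.2)) := by
  have : IsProbabilityMeasure (μ.map E) := Measure.isProbabilityMeasure_map hE.aemeasurable
  have : IsProbabilityMeasure (μ.map fun ω => (Y ω, Z ω)) :=
    Measure.isProbabilityMeasure_map (hY.prodMk hZ).aemeasurable
  have hW : Measurable fun ω => f (Z ω, E ω) := hf.comp (hZ.prodMk hE)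
  have hg : Measurable fun x : (α × β) × γ => (x.1, f (x.1.2, x.2)) :=
    measurable_fst.prodMk (hf.comp ((measurable_snd.comp measurable_fst).prodMk measurable_snd))
  have : IsProbabilityMeasure (μ.map (fun ω => ((Y ω, Z ω), f (Z ω, E ω)))) :=
    Measure.isProbabilityMeasure_map ((hY.prodMk hZ).prodMk hW).aemeasurable
  have : IsProbabilityMeasure (((μ.map fun ω => (Y ω, Z ω)).prod (μ.map E)).map
      fun x => (x.1, f (x.1.2, x.2))) := Measure.isProbabilityMeasure_map hg.aemeasurable
  refine Measure.ext_prod₃' fun {A D B} hA hD hB => ?_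
  set k : β → ℝ := fun z => (μ.map E).real (Prod.mk z ⁻¹' (f ⁻¹' B)) with hk
  have hkm : Measurable k := (measurable_measure_prodMk_left (hf hB)).ennreal_toReal
  have hkle : ∀ z, ‖k z‖ ≤ 1 := fun z => by
    rw [Real.norm_of_nonneg measureReal_nonneg]; exact measureReal_le_one
  have hcond := condProb_of_indepFun hZ hE hZE (hf hB)
  have hA' : MeasurableSet (Y ⁻¹' A) := hY hA
  have hB' : MeasurableSet ((fun ω => f (Z ω, E ω)) ⁻¹' B) := hW hB
  have hD' : MeasurableSet[mβ.comap Z] (Z ⁻¹' D) := ⟨D, hD, rfl⟩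
  have hintA : Integrable ((Y ⁻¹' A).indicator fun _ => (1 : ℝ)) μ :=
    (integrable_const 1).indicator hA'
  have hkZ : AEStronglyMeasurable (k ∘ Z) μ := (hkm.comp hZ).aestronglyMeasurable
  have hintkA : Integrable ((k ∘ Z) * (Y ⁻¹' A).indicator fun _ => (1 : ℝ)) μ :=
    hintA.bdd_mul hkZ (Filter.Eventually.of_forall fun ω => hkle (Z ω))
  have hpull : μ[(k ∘ Z) * (Y ⁻¹' A).indicator fun _ => (1 : ℝ) | mβ.comap Z] =ᵐ[μ]
      (k ∘ Z) * μ⟦Y ⁻¹' A | mβ.comap Z⟧ :=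
    condExp_mul_of_stronglyMeasurable_left
      (hkm.comp (comap_measurable Z)).stronglyMeasurable hintkA hintA
  -- With `k (Z)` the conditional probability of the event in `B`, conditional independence gives
  -- `P(A, B | Z) = k (Z) P(A | Z)`, which equals `E[k (Z) 1_A | Z]`. Integrating over `Z ⁻¹' D`
  -- removes the conditioning.
  have hreal : μ.real (Y ⁻¹' A ∩ (fun ω => f (Z ω, E ω)) ⁻¹' B ∩ Z ⁻¹' D)
      = ∫ ω in Z ⁻¹' D, ((k ∘ Z) * (Y ⁻¹' A).indicator fun _ => (1 : ℝ)) ω ∂μ := by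
    calc μ.real (Y ⁻¹' A ∩ (fun ω => f (Z ω, E ω)) ⁻¹' B ∩ Z ⁻¹' D)
        = ∫ ω in Z ⁻¹' D, (Y ⁻¹' A ∩ (fun ω => f (Z ω, E ω)) ⁻¹' B).indicator
            (fun _ => (1 : ℝ)) ω ∂μ := by
          rw [integral_indicator_const _ (hA'.inter hB'),
            measureReal_restrict_apply (hA'.inter hB'), smul_eq_mul, mul_one]
      _ = ∫ ω in Z ⁻¹' D, (μ⟦Y ⁻¹' A ∩ (fun ω => f (Z ω, E ω)) ⁻¹' B | mβ.comap Z⟧) ω ∂μ :=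
          (setIntegral_condExp hZ.comap_le ((integrable_const 1).indicator (hA'.inter hB'))
            hD').symm
      _ = ∫ ω in Z ⁻¹' D, (μ[(k ∘ Z) * (Y ⁻¹' A).indicator fun _ => (1 : ℝ) | mβ.comap Z]) ω ∂μ := by
          refine setIntegral_congr_ae (hZ hD) ?_
          filter_upwards [h A B hA hB, hcond, hpull] with ω h1 h2 h3 _
          rw [h1, h3, Pi.mul_apply, Pi.mul_apply, mul_comm]
          exact congrArg (· * _) h2.symm
      _ = _ := setIntegral_condExp hZ.comap_le hintkA hD'
  have hbox : MeasurableSet ((A ×ˢ D) ×ˢ B) := (hA.prod hD).prod hB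
  have hpre : MeasurableSet ((fun x : (α × β) × γ => (x.1, f (x.1.2, x.2))) ⁻¹' ((A ×ˢ D) ×ˢ B)) :=
    hg hbox
  rw [← ENNReal.toReal_eq_toReal_iff' (measure_ne_top _ _) (measure_ne_top _ _),
    Measure.map_apply ((hY.prodMk hZ).prodMk hW) hbox, Measure.map_apply hg hbox,
    Measure.prod_apply hpre, ← integral_toReal (measurable_measure_prodMk_left hpre).aemeasurable
      (Filter.Eventually.of_forall fun _ => measure_lt_top _ _),
    integral_map (hY.prodMk hZ).aemeasurable
      (measurable_measure_prodMk_left hpre).ennreal_toReal.aestronglyMeasurable]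
  have hset : (fun ω => ((Y ω, Z ω), f (Z ω, E ω))) ⁻¹' ((A ×ˢ D) ×ˢ B)
      = Y ⁻¹' A ∩ (fun ω => f (Z ω, E ω)) ⁻¹' B ∩ Z ⁻¹' D := by
    ext ω
    simp only [Set.mem_preimage, Set.mem_prod, Set.mem_inter_iff]
    tauto
  rw [hset]
  refine hreal.trans ?_
  rw [← integral_indicator (hZ hD)]
  refine integral_congr_ae (Filter.Eventually.of_forall fun ω => ?_)
  by_cases hz : Z ω ∈ D <;> by_cases hy : Y ω ∈ A <;>
    simp [hz, hy, hk, Set.indicator, measureReal_def, Set.preimage]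

end Conditioning

/-! ### Column selection and population regression -/

section Selection

variable {n p : ℕ}

/-- The matrix selecting the coordinates in `A`, in increasing order. -/
def selector (A : Finset (Fin p)) : Matrix (Fin A.card) (Fin p) ℝ :=
  (1 : Matrix (Fin p) (Fin p) ℝ).submatrix (A.orderEmbOfFin rfl) id

lemma cols_eq_mul (X : Matrix (Fin n) (Fin p) ℝ) (A : Finset (Fin p)) :
    cols X A = X * (selector A)ᵀ := by
  ext i j
  simp [cols, selector, Matrix.mul_apply, Matrix.one_apply]

lemma principal_eq_mul (C : Matrix (Fin p) (Fin p) ℝ) (A : Finset (Fin p)) :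
    principal C A = selector A * C * (selector A)ᵀ := by
  ext i j
  simp [principal, selector, Matrix.mul_apply, Matrix.one_apply]

/-- The matrix of population regression coefficients of the columns in `T` on those in `S`. -/
def regressionCoeff (C : Matrix (Fin p) (Fin p) ℝ) (S T : Finset (Fin p)) :
    Matrix (Fin S.card) (Fin T.card) ℝ :=
  (principal C S)⁻¹ * (selector S * C * (selector T)ᵀ)

/-- The matrix mapping a row to its population residuals in the regression of the columns in `T`
on those in `S`. -/
def residualMap (C : Matrix (Fin p) (Fin p) ℝ) (S T : Finset (Fin p)) :
    Matrix (Fin T.card) (Fin p) ℝ :=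
  selector T - (regressionCoeff C S T)ᵀ * selector S

/-- The normal equations: the coefficients are chosen to make the residuals uncorrelated with the
columns in `S`. -/
lemma selector_mul_residualMap {C : Matrix (Fin p) (Fin p) ℝ} {S T : Finset (Fin p)}
    (hCS : (principal C S).PosDef) : selector S * C * (residualMap C S T)ᵀ = 0 := by
  rw [residualMap, Matrix.transpose_sub, Matrix.transpose_mul, Matrix.transpose_transpose,
    Matrix.mul_sub, ← Matrix.mul_assoc, ← principal_eq_mul, regressionCoeff, ← Matrix.mul_assoc,
    Matrix.mul_nonsing_inv _ ((Matrix.isUnit_iff_isUnit_det _).mp hCS.isUnit), Matrix.one_mul,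
    sub_self]

lemma cols_eq_regression (X : Matrix (Fin n) (Fin p) ℝ) (C : Matrix (Fin p) (Fin p) ℝ)
    (S T : Finset (Fin p)) :
    cols X T = cols X S * regressionCoeff C S T + X * (residualMap C S T)ᵀ := by
  rw [residualMap, Matrix.transpose_sub, Matrix.transpose_mul, Matrix.transpose_transpose,
    Matrix.mul_sub, cols_eq_mul, cols_eq_mul, Matrix.mul_assoc]
  abel

lemma measurable_cols {α : Type*} [MeasurableSpace α] {X : α → Matrix (Fin n) (Fin p) ℝ}
    (hX : Measurable X) (A : Finset (Fin p)) : Measurable fun a => cols (X a) A :=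
  hX.matrix_submatrix _ _

end Selection

/-! ### From fixed `(Y, Z)` and fixed frame to random data and data-dependent frame -/

section Assembly

lemma map_gaussianVectors {Ω : Type*} [MeasurableSpace Ω] {μ : Measure Ω} [IsProbabilityMeasure μ]
    {M r d : ℕ} {v : Fin M → Fin r → Ω → EuclideanSpace ℝ (Fin d)}
    (hv : ∀ j k, Measurable (v j k))
    (hvlaw : ∀ j k, HasLaw (v j k) (stdGaussian (EuclideanSpace ℝ (Fin d))) μ)
    (hvindep : iIndepFun (fun jk : Fin M × Fin r => v jk.1 jk.2) μ) :
    μ.map (fun ω j k => v j k ω) = Measure.pi fun _ : Fin M => gaussianVectors r d := by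
  have h := (iIndepFun_iff_map_fun_eq_pi_map fun i : Fin M × Fin r =>
    (hv i.1 i.2).aemeasurable).mp hvindep
  simp only [(hvlaw _ _).map_eq] at h
  -- Currying the product over pairs `(j, k)` goes through `Measure.infinitePi`, which agrees with
  -- `Measure.pi` on finite index types.
  rw [← Measure.infinitePi_eq_pi] at h
  have h2 := Measure.infinitePi_map_curry (X := EuclideanSpace ℝ (Fin d))
    (μ := fun (_ : Fin M) (_ : Fin r) => stdGaussian (EuclideanSpace ℝ (Fin d)))
  have hm : Measurable fun ω (i : Fin M × Fin r) => v i.1 i.2 ω :=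
    measurable_pi_lambda _ fun i => hv i.1 i.2
  rw [← h, Measure.map_map (by fun_prop) hm] at h2
  simp only [Measure.infinitePi_eq_pi] at h2
  exact h2

lemma measurableSet_residualFrame {α : Type*} [MeasurableSpace α] {n s : ℕ}
    {Z : α → Matrix (Fin n) (Fin s) ℝ} {P : α → Matrix (Fin (n - s)) (Fin n) ℝ}
    (hZ : Measurable Z) (hP : Measurable P) : MeasurableSet {a | IsResidualFrame (Z a) (P a)} := by
  refine MeasurableSet.inter ?_ ?_
  · exact measurableSet_matrix_eq (hP.matrix_mul hP.matrix_transpose) measurable_const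
  · have hhat : Measurable fun a => hat (Z a) := measurable_hat.comp hZ
    have : {a | (P a)ᵀ * P a = 1 - hat (Z a)} = {a | (P a)ᵀ * P a + hat (Z a) = 1} := by
      ext a; exact eq_sub_iff_add_eq
    change MeasurableSet {a | (P a)ᵀ * P a = 1 - hat (Z a)}
    rw [this]
    exact measurableSet_matrix_eq
      ((hP.matrix_transpose.matrix_mul hP).matrix_add hhat) measurable_const

lemma measurableSet_isUnit_gram {α : Type*} [MeasurableSpace α] {n s : ℕ}
    {Z : α → Matrix (Fin n) (Fin s) ℝ} (hZ : Measurable Z) :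
    MeasurableSet {a | IsUnit ((Z a)ᵀ * Z a)} := by
  simp only [Matrix.isUnit_iff_isUnit_det, isUnit_iff_ne_zero]
  have hdet : Measurable fun A : Matrix (Fin s) (Fin s) ℝ => A.det :=
    (continuous_id.matrix_det : Continuous fun A : Matrix (Fin s) (Fin s) ℝ => A.det).measurable
  exact (measurableSet_eq_fun (hdet.comp (hZ.matrix_transpose.matrix_mul hZ))
    measurable_const).compl

/-- The map `((y, Z), E) ↦ ((y, Z), Z B + E)`. -/
def addResidual {𝓨 : Type*} {n s t : ℕ} (B : Matrix (Fin s) (Fin t) ℝ)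
    (x : (𝓨 × Matrix (Fin n) (Fin s) ℝ) × Matrix (Fin n) (Fin t) ℝ) :
    (𝓨 × Matrix (Fin n) (Fin s) ℝ) × Matrix (Fin n) (Fin t) ℝ :=
  (x.1, x.1.2 * B + x.2)

lemma measurable_addResidual {𝓨 : Type*} [MeasurableSpace 𝓨] {n s t : ℕ}
    (B : Matrix (Fin s) (Fin t) ℝ) :
    Measurable (addResidual B : (𝓨 × Matrix (Fin n) (Fin s) ℝ) × _ → _) :=
  measurable_fst.prodMk (((measurable_snd.comp measurable_fst).matrix_mul
    measurable_const).matrix_add measurable_snd)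

lemma measurableSet_pVal_copy {n s t M : ℕ} {𝓨 : Type*} [MeasurableSpace 𝓨]
    {stat : 𝓨 × Matrix (Fin n) (Fin t) ℝ × Matrix (Fin n) (Fin s) ℝ → ℝ}
    (hstat : Measurable stat) (α : ℝ) :
    MeasurableSet {z : (((𝓨 × Matrix (Fin n) (Fin s) ℝ) × Matrix (Fin n) (Fin t) ℝ) ×
        Matrix (Fin (n - s)) (Fin n) ℝ) ×
          (Fin M → Fin (min (n - s) t) → EuclideanSpace ℝ (Fin (n - s))) |
        pVal (stat (z.1.1.1.1, z.1.1.2, z.1.1.1.2))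
          (fun m => stat (z.1.1.1.1, copy z.1.1.1.2 z.1.1.2 z.1.2 (z.2 m), z.1.1.1.2)) ≤ α} := by
  refine measurableSet_pVal_le (hstat.comp (by fun_prop))
    (measurable_pi_lambda _ fun m => hstat.comp ?_) α
  have hc := measurable_copy (α := (((𝓨 × Matrix (Fin n) (Fin s) ℝ) ×
    Matrix (Fin n) (Fin t) ℝ) × Matrix (Fin (n - s)) (Fin n) ℝ) ×
      (Fin M → Fin (min (n - s) t) → EuclideanSpace ℝ (Fin (n - s))))
    (Z := fun z => z.1.1.1.2) (W := fun z => z.1.1.2) (P := fun z => z.1.2)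
    (v := fun z => z.2 m) (by fun_prop) (by fun_prop) (by fun_prop) (by fun_prop)
  fun_prop

/-- The p-value is super-uniform when, given `(Y, Z)`, the tested block is `Z B + E` with `E`
independent and rotation invariant. -/
lemma lintegral_pVal_le {n s t M : ℕ} {α : ℝ} (hα : 0 ≤ α)
    {𝓨 : Type*} [MeasurableSpace 𝓨] (ν : Measure (𝓨 × Matrix (Fin n) (Fin s) ℝ))
    [IsProbabilityMeasure ν] (ρ : Measure (Matrix (Fin n) (Fin t) ℝ)) [IsProbabilityMeasure ρ]
    (hρ : ∀ O : Matrix (Fin n) (Fin n) ℝ, Oᵀ * O = 1 → ρ.map (fun E => O * E) = ρ)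
    (B : Matrix (Fin s) (Fin t) ℝ)
    (η : Kernel ((𝓨 × Matrix (Fin n) (Fin s) ℝ) × Matrix (Fin n) (Fin t) ℝ)
      (Matrix (Fin (n - s)) (Fin n) ℝ)) [IsMarkovKernel η]
    (hframe : ∀ᵐ x ∂((ν.prod ρ).map (addResidual B)) ⊗ₘ η,
      IsUnit (x.1.1.2ᵀ * x.1.1.2) ∧ IsResidualFrame x.1.1.2 x.2)
    {stat : 𝓨 × Matrix (Fin n) (Fin t) ℝ × Matrix (Fin n) (Fin s) ℝ → ℝ}
    (hstat : Measurable stat) :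
    ∫⁻ x, Measure.pi (fun _ : Fin M => gaussianVectors (min (n - s) t) (n - s))
        {v | pVal (stat (x.1.1.1, x.1.2, x.1.1.2))
          (fun m => stat (x.1.1.1, copy x.1.1.2 x.1.2 x.2 (v m), x.1.1.2)) ≤ α}
        ∂(((ν.prod ρ).map (addResidual B)) ⊗ₘ η) ≤ ENNReal.ofReal α := by
  set F : ((𝓨 × Matrix (Fin n) (Fin s) ℝ) × Matrix (Fin n) (Fin t) ℝ) ×
      Matrix (Fin (n - s)) (Fin n) ℝ → ENNReal := fun x =>
    Measure.pi (fun _ : Fin M => gaussianVectors (min (n - s) t) (n - s))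
      {v | pVal (stat (x.1.1.1, x.1.2, x.1.1.2))
        (fun m => stat (x.1.1.1, copy x.1.1.2 x.1.2 x.2 (v m), x.1.1.2)) ≤ α} with hF
  have hFm : Measurable F := by
    exact measurable_measure_prodMk_left (measurableSet_pVal_copy hstat α)
  have hg := measurable_addResidual (𝓨 := 𝓨) (n := n) B
  have : IsProbabilityMeasure ((ν.prod ρ).map (addResidual B)) :=
    Measure.isProbabilityMeasure_map hg.aemeasurable
  have h1 := ae_of_ae_map hg.aemeasurable (Measure.ae_ae_of_ae_compProd hframe)
  have h2 := Measure.ae_ae_of_ae_prod h1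
  rw [Measure.lintegral_compProd hFm, lintegral_map hFm.lintegral_kernel_prod_right' hg,
    lintegral_prod (fun a => ∫⁻ b, F (addResidual B a, b) ∂η (addResidual B a))
      (hFm.lintegral_kernel_prod_right'.comp hg).aemeasurable]
  refine (lintegral_mono_ae (g := fun _ => ENNReal.ofReal α) ?_).trans (by simp)
  filter_upwards [h2] with ⟨y, z⟩ hyz
  change ∀ᵐ E ∂ρ, ∀ᵐ P ∂η ((y, z), z * B + E), IsUnit (zᵀ * z) ∧ IsResidualFrame z P at hyz
  -- The kernel `η` allows `P` to depend on `E`. A reference frame `P₀` is picked for `(y, z)`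
  -- alone; by `copyLaw_congr` every admissible `P` gives the same conditional probability as `P₀`.
  obtain ⟨E₀, hE₀⟩ := hyz.exists
  obtain ⟨P₀, hz, hP₀⟩ := hE₀.exists
  have hΦ : Measurable fun W : Matrix (Fin n) (Fin t) ℝ => stat (y, W, z) :=
    hstat.comp (by fun_prop)
  refine le_trans (le_of_eq ?_) (lintegral_copy_pVal_le hP₀ hz ρ hρ B M hΦ hα)
  refine lintegral_congr_ae ?_
  filter_upwards [hyz] with E hE
  have hconst : ∀ᵐ P ∂η ((y, z), z * B + E), F (((y, z), z * B + E), P) =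
      F (((y, z), z * B + E), P₀) := by
    filter_upwards [hE] with P hP
    simp only [hF]
    rw [pi_copy_pVal_eq M hΦ, pi_copy_pVal_eq M hΦ, copyLaw_congr hP.2 hP₀]
  change ∫⁻ P, F (((y, z), z * B + E), P) ∂η ((y, z), z * B + E) = _
  rw [lintegral_congr_ae hconst, lintegral_const, measure_univ, mul_one]

end Assembly

/-! ### Regression residuals and the joint law of the data -/

section Residual

variable {n p : ℕ} {C : Matrix (Fin p) (Fin p) ℝ} {S T : Finset (Fin p)}

/-- The law of the matrix of population residuals in the regression of the columns in `T` on
those in `S`. -/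
def residualLaw (n : ℕ) (C : Matrix (Fin p) (Fin p) ℝ) (S T : Finset (Fin p)) :
    Measure (Matrix (Fin n) (Fin T.card) ℝ) :=
  (matrixGaussian n C).map fun X => X * (residualMap C S T)ᵀ

instance : IsProbabilityMeasure (residualLaw n C S T) :=
  Measure.isProbabilityMeasure_map (measurable_mul_right _).aemeasurable

/-- Taking residuals multiplies on the right, so it commutes with rotations acting on the left. -/
lemma residualLaw_map_orthogonal (hC : C.PosSemidef) (O : Matrix (Fin n) (Fin n) ℝ)
    (hO : Oᵀ * O = 1) :
    (residualLaw n C S T).map (fun E => O * E) = residualLaw n C S T := by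
  rw [residualLaw, Measure.map_map (measurable_mul_left _) (measurable_mul_right _)]
  conv_rhs => rw [← matrixGaussian_map_orthogonal hC O hO,
    Measure.map_map (measurable_mul_right _) (measurable_mul_left _)]
  refine congrArg (fun f => Measure.map f _) (funext fun X => ?_)
  exact (Matrix.mul_assoc _ _ _).symm

variable {Ω : Type*} [MeasurableSpace Ω] {μ : Measure Ω} [IsProbabilityMeasure μ]
  {X : Ω → Matrix (Fin n) (Fin p) ℝ}

lemma map_residual {μ : Measure Ω} (hX : Measurable X) (hXmap : μ.map X = matrixGaussian n C) :
    μ.map (fun ω => X ω * (residualMap C S T)ᵀ) = residualLaw n C S T := by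
  rw [residualLaw, ← hXmap, Measure.map_map (measurable_mul_right _) hX]
  rfl

lemma indepFun_cols_residual (hC : C.PosSemidef) (hCS : (principal C S).PosDef)
    (hX : Measurable X) (hXmap : μ.map X = matrixGaussian n C) :
    IndepFun (fun ω => cols (X ω) S) (fun ω => X ω * (residualMap C S T)ᵀ) μ := by
  simp only [cols_eq_mul]
  rw [indepFun_iff_map_prod_eq_prod_map_map (hX.matrix_mul measurable_const).aemeasurable
    (hX.matrix_mul measurable_const).aemeasurable]
  have h := matrixGaussian_map_prod (n := n) hC (selector_mul_residualMap (T := T) hCS)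
  rw [← hXmap, Measure.map_map ((measurable_mul_right _).prodMk (measurable_mul_right _)) hX,
    Measure.map_map (measurable_mul_right _) hX, Measure.map_map (measurable_mul_right _) hX] at h
  exact h

/-- Under conditional independence, the data have the law of `(Y, Z, Z B + E)` with Gaussian
residuals `E` independent of `(Y, Z)`. -/
lemma map_response_cols {𝓨 : Type*} [MeasurableSpace 𝓨] {Y : Ω → 𝓨} (hY : Measurable Y)
    (hC : C.PosSemidef) (hCS : (principal C S).PosDef) (hX : Measurable X)
    (hXmap : μ.map X = matrixGaussian n C)
    (hcond : CondIndepGiven Y (fun ω => cols (X ω) T) (fun ω => cols (X ω) S) μ) :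
    μ.map (fun ω => ((Y ω, cols (X ω) S), cols (X ω) T))
      = ((μ.map fun ω => (Y ω, cols (X ω) S)).prod (residualLaw n C S T)).map
        (addResidual (regressionCoeff C S T)) := by
  let f : Matrix (Fin n) (Fin S.card) ℝ × Matrix (Fin n) (Fin T.card) ℝ →
    Matrix (Fin n) (Fin T.card) ℝ := fun x => x.1 * regressionCoeff C S T + x.2
  have hf : Measurable f :=
    (measurable_fst.matrix_mul measurable_const).matrix_add measurable_snd
  have hWE : ∀ ω, cols (X ω) T = f (cols (X ω) S, X ω * (residualMap C S T)ᵀ) := fun ω =>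
    cols_eq_regression (X ω) C S T
  simp only [hWE] at hcond ⊢
  rw [hcond.map_eq hY (measurable_cols hX S) (hX.matrix_mul measurable_const) hf
    (indepFun_cols_residual hC hCS hX hXmap), map_residual hX hXmap]
  rfl

end Residual

end MVNCRT

end

/-! ### The main theorem -/

theorem mainTheorem2
    {Ω : Type*} [MeasurableSpace Ω] (μ : Measure Ω) [IsProbabilityMeasure μ]
    (n p M : ℕ) (S T : Finset (Fin p)) (hdisj : Disjoint S T) (hunion : S ∪ T = Finset.univ)
    (hn : S.card < n)
    -- the covariates: i.i.d. rows with law N_p(0, C)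
    (C : Matrix (Fin p) (Fin p) ℝ) (hC : C.PosSemidef) (hCS : (MVNCRT.principal C S).PosDef)
    (X : Ω → Matrix (Fin n) (Fin p) ℝ) (hX : Measurable X)
    (hXlaw : ∀ i, HasLaw (fun ω => WithLp.toLp 2 (X ω i)) (multivariateGaussian 0 C) μ)
    (hXindep : iIndepFun (fun i ω => X ω i) μ)
    -- the responses
    (Y : Ω → Fin n → ℝ) (hY : Measurable Y)
    -- any choice of the (n - s) × n matrix P; it may depend on the data
    (P : Ω → Matrix (Fin (n - S.card)) (Fin n) ℝ) (hP : Measurable P)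
    (hPframe : ∀ᵐ ω ∂μ, IsUnit ((MVNCRT.cols (X ω) S)ᵀ * MVNCRT.cols (X ω) S) →
      MVNCRT.IsResidualFrame (MVNCRT.cols (X ω) S) (P ω))
    -- the i.i.d. standard normal vectors, drawn independently of the data
    (v : Fin M → Fin (min (n - S.card) T.card) → Ω → EuclideanSpace ℝ (Fin (n - S.card)))
    (hv : ∀ j k, Measurable (v j k))
    (hvlaw : ∀ j k, HasLaw (v j k) (stdGaussian (EuclideanSpace ℝ (Fin (n - S.card)))) μ)
    (hvindep : iIndepFun
      (fun jk : Fin M × Fin (min (n - S.card) T.card) => v jk.1 jk.2) μ)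
    (hvdata : IndepFun (fun ω j k => v j k ω) (fun ω => (Y ω, X ω, P ω)) μ)
    -- the copies
    (Xc : Fin M → Ω → Matrix (Fin n) (Fin T.card) ℝ)
    (hXc : ∀ j ω, Xc j ω = MVNCRT.copy (MVNCRT.cols (X ω) S) (MVNCRT.cols (X ω) T) (P ω)
      (fun k => v j k ω)) :
    (∀ᵐ ω ∂μ, ∀ j,
      (MVNCRT.cols (X ω) T)ᵀ * MVNCRT.cols (X ω) S = (Xc j ω)ᵀ * MVNCRT.cols (X ω) S ∧
      (MVNCRT.cols (X ω) T)ᵀ * MVNCRT.cols (X ω) T = (Xc j ω)ᵀ * Xc j ω) ∧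
    (MVNCRT.CondIndepGiven Y (fun ω => MVNCRT.cols (X ω) T) (fun ω => MVNCRT.cols (X ω) S) μ →
      ∀ stat : (Fin n → ℝ) × Matrix (Fin n) (Fin T.card) ℝ × Matrix (Fin n) (Fin S.card) ℝ → ℝ,
        Measurable stat → ∀ α : ℝ, 0 < α → α < 1 →
          μ {ω | MVNCRT.pVal (stat (Y ω, MVNCRT.cols (X ω) T, MVNCRT.cols (X ω) S))
            (fun m => stat (Y ω, Xc m ω, MVNCRT.cols (X ω) S)) ≤ α} ≤ ENNReal.ofReal α) := by
  have hZ : Measurable fun ω => MVNCRT.cols (X ω) S := MVNCRT.measurable_cols hX S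
  have hW : Measurable fun ω => MVNCRT.cols (X ω) T := MVNCRT.measurable_cols hX T
  have hXmap := MVNCRT.map_eq_matrixGaussian hX hXlaw hXindep
  have hunit : ∀ᵐ ω ∂μ, IsUnit ((MVNCRT.cols (X ω) S)ᵀ * MVNCRT.cols (X ω) S) := by
    have := MVNCRT.ae_isUnit_gram (J := MVNCRT.selector S) hC hn.le
      (by rw [← MVNCRT.principal_eq_mul]; exact hCS) hX hXlaw hXindep
    filter_upwards [this] with ω hω
    rwa [MVNCRT.cols_eq_mul]
  have hvm : Measurable fun ω j k => v j k ω :=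
    measurable_pi_lambda _ fun j => measurable_pi_lambda _ fun k => hv j k
  have hvmap := MVNCRT.map_gaussianVectors hv hvlaw hvindep
  refine ⟨?_, fun hcond stat hstat α hα _ => ?_⟩
  · have hli : ∀ᵐ ω ∂μ, ∀ j, LinearIndependent ℝ fun k => v j k ω := by
      rw [ae_all_iff]
      intro j
      have hmp : MeasurePreserving (fun ω k => v j k ω) μ
          (MVNCRT.gaussianVectors (min (n - S.card) T.card) (n - S.card)) :=
        (measurePreserving_eval (fun _ : Fin M => MVNCRT.gaussianVectors
          (min (n - S.card) T.card) (n - S.card)) j).comp ⟨hvm, hvmap⟩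
      exact hmp.quasiMeasurePreserving.ae
        (MVNCRT.ae_linearIndependent_gaussianVectors (min_le_left _ _))
    filter_upwards [hli, hunit, hPframe] with ω h1 h2 h3 j
    rw [hXc]
    exact ⟨MVNCRT.transpose_mul_eq_copy_transpose_mul (h3 h2) h2 _ _,
      MVNCRT.transpose_mul_self_eq_copy (h3 h2) h2 _ (h1 j)⟩
  · set q : Ω → ((Fin n → ℝ) × Matrix (Fin n) (Fin S.card) ℝ) × Matrix (Fin n) (Fin T.card) ℝ :=
      fun ω => ((Y ω, MVNCRT.cols (X ω) S), MVNCRT.cols (X ω) T) with hq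
    have hqm : Measurable q := (hY.prodMk hZ).prodMk hW
    have hYZprob : IsProbabilityMeasure (μ.map fun ω => (Y ω, MVNCRT.cols (X ω) S)) :=
      Measure.isProbabilityMeasure_map (hY.prodMk hZ).aemeasurable
    have hqmap := MVNCRT.map_response_cols hY hC hCS hX hXmap hcond
    -- The dependence of `P` on the data is encoded by a regular conditional distribution, available
    -- because matrices form a standard Borel space.
    have hqP : μ.map (fun ω => (q ω, P ω)) = μ.map q ⊗ₘ condDistrib P q μ :=
      (compProd_map_condDistrib hP.aemeasurable).symm
    have hframe : ∀ᵐ x ∂(μ.map q ⊗ₘ condDistrib P q μ),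
        IsUnit (x.1.1.2ᵀ * x.1.1.2) ∧ MVNCRT.IsResidualFrame x.1.1.2 x.2 := by
      rw [← hqP, ae_map_iff (hqm.prodMk hP).aemeasurable]
      · filter_upwards [hunit, hPframe] with ω h1 h2
        exact ⟨h1, h2 h1⟩
      · exact (MVNCRT.measurableSet_isUnit_gram (by fun_prop)).inter
          (MVNCRT.measurableSet_residualFrame (by fun_prop) (by fun_prop))
    have hindep : IndepFun (fun ω => (q ω, P ω)) (fun ω j k => v j k ω) μ := by
      have hφ : Measurable fun x : (Fin n → ℝ) × Matrix (Fin n) (Fin p) ℝ ×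
          Matrix (Fin (n - S.card)) (Fin n) ℝ =>
            (((x.1, MVNCRT.cols x.2.1 S), MVNCRT.cols x.2.1 T), x.2.2) := by
        have h1 := MVNCRT.measurable_cols (α := (Fin n → ℝ) × Matrix (Fin n) (Fin p) ℝ ×
          Matrix (Fin (n - S.card)) (Fin n) ℝ) (X := fun x => x.2.1) (by fun_prop)
        exact ((measurable_fst.prodMk (h1 S)).prodMk (h1 T)).prodMk (by fun_prop)
      exact hvdata.symm.comp hφ measurable_id
    have hjoint := (indepFun_iff_map_prod_eq_prod_map_map (hqm.prodMk hP).aemeasurable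
      hvm.aemeasurable).mp hindep
    set A : Set ((((((Fin n → ℝ) × Matrix (Fin n) (Fin S.card) ℝ) × Matrix (Fin n) (Fin T.card) ℝ) ×
        Matrix (Fin (n - S.card)) (Fin n) ℝ)) × (Fin M → Fin (min (n - S.card) T.card) →
          EuclideanSpace ℝ (Fin (n - S.card)))) :=
      {z | MVNCRT.pVal (stat (z.1.1.1.1, z.1.1.2, z.1.1.1.2)) (fun m => stat (z.1.1.1.1,
        MVNCRT.copy z.1.1.1.2 z.1.1.2 z.1.2 (z.2 m), z.1.1.1.2)) ≤ α} with hA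
    have hAm : MeasurableSet A := MVNCRT.measurableSet_pVal_copy hstat α
    have hevent : {ω | MVNCRT.pVal (stat (Y ω, MVNCRT.cols (X ω) T, MVNCRT.cols (X ω) S))
        (fun m => stat (Y ω, Xc m ω, MVNCRT.cols (X ω) S)) ≤ α}
        = (fun ω => ((q ω, P ω), fun j k => v j k ω)) ⁻¹' A := by
      ext ω
      simp [hA, hq, hXc]
    have hmain := MVNCRT.lintegral_pVal_le (M := M) hα.le
      (μ.map fun ω => (Y ω, MVNCRT.cols (X ω) S)) (MVNCRT.residualLaw n C S T)
      (fun O hO => MVNCRT.residualLaw_map_orthogonal hC O hO) (MVNCRT.regressionCoeff C S T)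
      (condDistrib P q μ) (by rw [← hqmap]; exact hframe) hstat
    -- The Gaussian vectors are independent of `(q, P)`, so Fubini integrates them out first and
    -- leaves the integral bounded in `hmain`.
    rw [hevent, ← Measure.map_apply ((hqm.prodMk hP).prodMk hvm) hAm, hjoint, hvmap,
      Measure.prod_apply hAm, hqP, hqmap]
    exact hmain
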